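/- Let $n\ge 1$, $\chi\in\{1,0,-1\}$. Consider the $(n+2)$-dimensional scalar–tensor theory with Lagrangian $\tfrac12F(\phi)R-\tfrac12(\nabla\phi)^2$, whose field equations are $$G_{\mu\nu}=T_{\mu\nu}:=\frac1{F(\phi)}\Big[\nabla_\mu\nabla_\nu F(\phi)+\nabla_\mu\phi\nabla_\nu\phi-g_{\mu\nu}\nabla^2F(\phi)-\tfrac12 g_{\mu\nu}(\nabla\phi)^2\Big],\qquad \nabla^2\phi=-\tfrac12F'(\phi)R .$$ Take the metric $ds^2=-P(r)\,dt^2+Q(r)\,dr^2+r^2d\sigma_n^2$ with $PQ>0$, where $d\sigma_n^2$ is a (chart of a) smooth Riemannian metric of constant curvature $\chi$ in dimension $n$, and a scalar $\phi=\phi(r)$; $P,Q,\phi$ are smooth on a nonempty open interval $I\subset(0,\infty)$ and $F(\phi(r))\neq0$ on $I$. 1. (Choice of $F$.) For every smooth $F$, each solution satisfies $\big(\tfrac n2F+\tfrac{n+1}2F'^2\big)R=\big(\tfrac n2+(n+1)F''\big)(\nabla\phi)^2$. If $\phi'\ne0$ on $I$ and $R=0$, then $\tfrac n2+(n+1)F''=0$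 along $\phi(I)$, so $F(\phi)=-\frac{n}{4(n+1)}\phi^2+C_1\phi+C_2$ there. From now on $F(\phi)=1-\frac{n}{4(n+1)}\phi^2$. 2. Every solution of the field equations satisfies $R=0$ and $\nabla^2\phi=0$; if moreover $T^r_r=T^t_t$, then $PQ$ is a positive constant. 3. Suppose only that $PQ$ is a positive constant, $\nabla^2\phi=0$, $T^r_r=T^t_t$, and $\phi$ is not constant on $I$. Then there are constants $M$, $K\neq0$, $b\ne0$ such that $r\ne M$ on $I$ and $$\phi=K|r-M|^{-n/2},\qquad Q^{-1}=b\,r^{-n}|r-M|^{1+n/2}.$$ Moreover $T^{\theta_i}_{\theta_i}=-\tfrac2nT^r_r$ for all $i$ (no summation), and $k=-2/n$ is the only constant with $T^{\theta_i}_{\theta_i}=kT^r_r$ on $I$. If in addition $T^r_r=C/r^{n+2}$ for some constant $C$, then $n=2$ (space-time dimension $N=4$), and for some $M\ne0$, $b\neq0$: $r\neq M$ on $I$, $\phi=\pm\sqrt6M/(r-M)$, $Q^{-1}=b(1-M/r)^2$ and $C=-bM^2$. 4. If the field equations hold, $T^r_r=T^t_t$, $T^{\theta_i}_{\theta_i}=kT^r_r$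 for all $i$ with a constant $k$, and $\phi$ is not constant on $I$, then $k=-2/n$, $n=2$, $\chi\ne0$, and there are constants $M\neq0$, $c>0$ ($c$ is a rescaling of $t$) such that on $I$ (where $r\ne M$) $$P=c\,\chi\Big(1-\frac Mr\Big)^2,\quad Q^{-1}=\chi\Big(1-\frac Mr\Big)^2,\quad \phi=\pm\frac{\sqrt6\,M}{r-M},\quad T^r_r=T^t_t=-\frac{\chi M^2}{r^4}.$$ 5. Conversely, for $n=2$, $\chi=\pm1$, any $M\neq0$ and either sign, $P=Q^{-1}=\chi(1-M/r)^2$ and $\phi=\pm\sqrt6M/(r-M)$ satisfy the field equations, with $F(\phi)\neq 0$, $T^r_r=T^t_t=-\chi M^2/r^4$ and $T^{\theta_i}_{\theta_i}=-T^r_r$, at all $r>0$ with $r\ne M$, $r\neq2M$. For $\chi=1$ the metric is the extremal Reissner–Nordström metric. -/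

import Mathlib

open scoped ContDiff

noncomputable section

namespace ScalarTensor

/-! ## Tensor calculus in a coordinate chart

A metric is a matrix-valued function `g` of the coordinates `x : ι → ℝ`; all the objects below are
the usual coordinate components of the corresponding tensors. -/

section Chart

variable {ι : Type} [Fintype ι] [DecidableEq ι]

/-- Partial derivative `∂ᵢ u` at `x`. -/
def pd (i : ι) (u : (ι → ℝ) → ℝ) (x : ι → ℝ) : ℝ :=
  deriv (fun s => u (Function.update x i s)) (x i)

/-- Christoffel symbols `Γⁱⱼₖ` of the Levi-Civita connection. -/
def christoffel (g : (ι → ℝ) → Matrix ι ι ℝ) (i j k : ι) (x : ι → ℝ) : ℝ :=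
  (1 / 2) * ∑ l, (g x)⁻¹ i l *
    (pd j (fun y => g y l k) x + pd k (fun y => g y l j) x - pd l (fun y => g y j k) x)

/-- Riemann tensor
`Rⁱⱼₖₗ = ∂ₖ Γⁱₗⱼ - ∂ₗ Γⁱₖⱼ + Γⁱₖₘ Γᵐₗⱼ - Γⁱₗₘ Γᵐₖⱼ`. -/
def riemann (g : (ι → ℝ) → Matrix ι ι ℝ) (i j k l : ι) (x : ι → ℝ) : ℝ :=
  pd k (christoffel g i l j) x - pd l (christoffel g i k j) x
    + ∑ m, (christoffel g i k m x * christoffel g m l j x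
      - christoffel g i l m x * christoffel g m k j x)

/-- Ricci tensor `Rⱼₗ = Rⁱⱼᵢₗ`. -/
def ricci (g : (ι → ℝ) → Matrix ι ι ℝ) (j l : ι) (x : ι → ℝ) : ℝ :=
  ∑ i, riemann g i j i l x

/-- Scalar curvature `R = gⁱʲ Rᵢⱼ`. -/
def scalarCurvature (g : (ι → ℝ) → Matrix ι ι ℝ) (x : ι → ℝ) : ℝ :=
  ∑ i, ∑ j, (g x)⁻¹ i j * ricci g i j x

/-- Einstein tensor `Gᵢⱼ = Rᵢⱼ - ½ R gᵢⱼ`. -/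
def einstein (g : (ι → ℝ) → Matrix ι ι ℝ) (i j : ι) (x : ι → ℝ) : ℝ :=
  ricci g i j x - (1 / 2) * scalarCurvature g x * g x i j

/-- Second covariant derivative `∇ᵢ∇ⱼ u` of a function. -/
def hessian (g : (ι → ℝ) → Matrix ι ι ℝ) (u : (ι → ℝ) → ℝ) (i j : ι) (x : ι → ℝ) : ℝ :=
  pd i (pd j u) x - ∑ k, christoffel g k i j x * pd k u x

/-- `∇²u = gⁱʲ ∇ᵢ∇ⱼ u`. -/
def box (g : (ι → ℝ) → Matrix ι ι ℝ) (u : (ι → ℝ) → ℝ) (x : ι → ℝ) : ℝ :=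
  ∑ i, ∑ j, (g x)⁻¹ i j * hessian g u i j x

/-- `(∇u)² = gⁱʲ ∂ᵢu ∂ⱼu`. -/
def gradSq (g : (ι → ℝ) → Matrix ι ι ℝ) (u : (ι → ℝ) → ℝ) (x : ι → ℝ) : ℝ :=
  ∑ i, ∑ j, (g x)⁻¹ i j * (pd i u x * pd j u x)

/-! ## The scalar-tensor theory -/

/-- Energy-momentum tensor of the theory with Lagrangian `½ F(φ) R - ½ (∇φ)²`:
`Tᵢⱼ = F(φ)⁻¹ [∇ᵢ∇ⱼ F(φ) + ∇ᵢφ ∇ⱼφ - gᵢⱼ ∇²F(φ) - ½ gᵢⱼ (∇φ)²]`. -/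
def stress (F : ℝ → ℝ) (g : (ι → ℝ) → Matrix ι ι ℝ) (φ : (ι → ℝ) → ℝ) (i j : ι)
    (x : ι → ℝ) : ℝ :=
  (F (φ x))⁻¹ * (hessian g (fun y => F (φ y)) i j x + pd i φ x * pd j φ x
    - g x i j * box g (fun y => F (φ y)) x - (1 / 2) * g x i j * gradSq g φ x)

/-- Mixed components `Tⁱⱼ = gⁱᵏ Tₖⱼ`. -/
def mixedStress (F : ℝ → ℝ) (g : (ι → ℝ) → Matrix ι ι ℝ) (φ : (ι → ℝ) → ℝ) (i j : ι)
    (x : ι → ℝ) : ℝ :=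
  ∑ k, (g x)⁻¹ i k * stress F g φ k j x

/-- The field equations `Gᵢⱼ = Tᵢⱼ` and `∇²φ = -½ F'(φ) R` on the set `D` of the chart. -/
def FieldEquations (F : ℝ → ℝ) (g : (ι → ℝ) → Matrix ι ι ℝ) (φ : (ι → ℝ) → ℝ)
    (D : Set (ι → ℝ)) : Prop :=
  ∀ x ∈ D, (∀ i j, einstein g i j x = stress F g φ i j x) ∧
    box g φ x = -(1 / 2) * deriv F (φ x) * scalarCurvature g x

end Chart

/-- The coupling function `F(φ) = 1 - n φ² / (4 (n + 1))`. -/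
def coupling (n : ℕ) (φ : ℝ) : ℝ := 1 - (n : ℝ) / (4 * ((n : ℝ) + 1)) * φ ^ 2

/-! ## Static configurations

The coordinates on the `(n + 2)`-dimensional space-time are indexed by `Fin 2 ⊕ Fin n`:
`t = x (inl 0)`, `r = x (inl 1)` and `θᵢ = x (inr i)`. -/

/-- Index of the time coordinate. -/
def tIdx (n : ℕ) : Fin 2 ⊕ Fin n := Sum.inl 0

/-- Index of the radial coordinate. -/
def rIdx (n : ℕ) : Fin 2 ⊕ Fin n := Sum.inl 1

/-- `h` is a smooth Riemannian metric on the (nonempty) chart domain `U ⊆ ℝⁿ` with constant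
curvature `χ`, i.e. `Rⁱⱼₖₗ = χ (δⁱₖ hⱼₗ - δⁱₗ hⱼₖ)`, so that its scalar curvature is
`n (n - 1) χ`. -/
structure IsConstantCurvatureBase {n : ℕ} (χ : ℝ) (U : Set (Fin n → ℝ))
    (h : (Fin n → ℝ) → Matrix (Fin n) (Fin n) ℝ) : Prop where
  isOpen : IsOpen U
  nonempty : U.Nonempty
  smooth : ∀ i j, ContDiffOn ℝ ∞ (fun θ => h θ i j) U
  posDef : ∀ θ ∈ U, (h θ).PosDef
  curvature : ∀ θ ∈ U, ∀ i j k l, riemann h i j k l θ =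
    χ * ((if i = k then h θ j l else 0) - (if i = l then h θ j k else 0))

/-- The metric `ds² = -P(r) dt² + Q(r) dr² + r² dσ²`, where `dσ² = hᵢⱼ(θ) dθᵢ dθⱼ`
(so `P = N²` and `Q = A²` where these are positive). -/
def staticMetric {n : ℕ} (P Q : ℝ → ℝ) (h : (Fin n → ℝ) → Matrix (Fin n) (Fin n) ℝ)
    (x : Fin 2 ⊕ Fin n → ℝ) : Matrix (Fin 2 ⊕ Fin n) (Fin 2 ⊕ Fin n) ℝ :=
  Matrix.fromBlocks (Matrix.diagonal ![-P (x (rIdx n)), Q (x (rIdx n))]) 0 0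
    ((x (rIdx n)) ^ 2 • h (fun i => x (Sum.inr i)))

/-- A scalar field depending on the radial coordinate only. -/
def radial (n : ℕ) (φ : ℝ → ℝ) (x : Fin 2 ⊕ Fin n → ℝ) : ℝ := φ (x (rIdx n))

/-- The part of the space-time chart with radii in `I` and base point in `U`. -/
def region {n : ℕ} (I : Set ℝ) (U : Set (Fin n → ℝ)) : Set (Fin 2 ⊕ Fin n → ℝ) :=
  {x | x (rIdx n) ∈ I ∧ (fun i => x (Sum.inr i)) ∈ U}

/-- `P`, `Q`, `φ` are smooth on the nonempty open interval `I` of positive radii, and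
`-P dt² + Q dr² + r² dσ²` has Lorentzian signature there. -/
structure IsStaticConfiguration (I : Set ℝ) (P Q φ : ℝ → ℝ) : Prop where
  isOpen : IsOpen I
  ordConnected : I.OrdConnected
  nonempty : I.Nonempty
  pos : ∀ r ∈ I, 0 < r
  smooth_P : ContDiffOn ℝ ∞ P I
  smooth_Q : ContDiffOn ℝ ∞ Q I
  smooth_φ : ContDiffOn ℝ ∞ φ I
  lorentzian : ∀ r ∈ I, 0 < P r * Q r

/-- The condition `Tʳᵣ = Tᵗₜ` on `D`. -/
def RadialEqTime {n : ℕ} (F : ℝ → ℝ)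
    (g : (Fin 2 ⊕ Fin n → ℝ) → Matrix (Fin 2 ⊕ Fin n) (Fin 2 ⊕ Fin n) ℝ)
    (φ : (Fin 2 ⊕ Fin n → ℝ) → ℝ) (D : Set (Fin 2 ⊕ Fin n → ℝ)) : Prop :=
  ∀ x ∈ D, mixedStress F g φ (rIdx n) (rIdx n) x = mixedStress F g φ (tIdx n) (tIdx n) x

/-- The condition `T^{θᵢ}_{θᵢ} = k Tʳᵣ` (all `i`, no summation) on `D`, with a constant `k`. -/
def AngularEqMul {n : ℕ} (F : ℝ → ℝ)
    (g : (Fin 2 ⊕ Fin n → ℝ) → Matrix (Fin 2 ⊕ Fin n) (Fin 2 ⊕ Fin n) ℝ)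
    (φ : (Fin 2 ⊕ Fin n → ℝ) → ℝ) (D : Set (Fin 2 ⊕ Fin n → ℝ)) (k : ℝ) : Prop :=
  ∀ x ∈ D, ∀ i : Fin n, mixedStress F g φ (Sum.inr i) (Sum.inr i) x =
    k * mixedStress F g φ (rIdx n) (rIdx n) x

/-- The condition `Tʳᵣ = C / rᵖ` on `D`. -/
def RadialEqPower {n : ℕ} (F : ℝ → ℝ)
    (g : (Fin 2 ⊕ Fin n → ℝ) → Matrix (Fin 2 ⊕ Fin n) (Fin 2 ⊕ Fin n) ℝ)
    (φ : (Fin 2 ⊕ Fin n → ℝ) → ℝ) (D : Set (Fin 2 ⊕ Fin n → ℝ)) (C : ℝ) (p : ℕ) : Prop :=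
  ∀ x ∈ D, mixedStress F g φ (rIdx n) (rIdx n) x = C / (x (rIdx n)) ^ p

end ScalarTensor

end

open ScalarTensor

open ScalarTensor
open scoped Topology

noncomputable section

set_option linter.unusedSimpArgs false

/-! Every tensor in play is a multiple of the metric on each of the time, radial and base blocks, so
`fieldEquations_iff` and its companions turn the conditions on the chart into ordinary differential
equations in `r`. The trace of the field equations, with `∇²F(φ) = F'∇²φ + F''(∇φ)²`, gives the
identity between `R` and `(∇φ)²`. For the chosen `F` the coefficient of `R` is `n/2` and that of
`(∇φ)²` is zero, so `R = 0` and then `∇²φ = 0`. The difference of the radial and time equations is a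
nonzero multiple of `(PQ)'`.

With `f = 1/Q` and `P = c f`, the equation `∇²φ = 0` integrates to `rⁿ f φ' = κ`, while `Tʳᵣ = Tᵗₜ`
becomes `n φ φ'' = (n + 2) φ'²`, that is `n φ = -2 (r - M) φ'` (`exists_first_integrals`). These two
integrals give the power laws (`exists_power_law`) and the stress tensor, whose vanishing trace
yields the ratio `-2/n`. If `Tʳᵣ = C / r^(n+2)`, clearing denominators in the variable `z = √|r -
M|` produces a polynomial identity whose coefficients force `n = 2` and `K² = 6 M²`
(`stressRadius_power_law`).

For a solution of the field equations, `R = 0` reads `(rⁿ (f - χ))'' = 0`, so `rⁿ f` equals both `χ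
rⁿ + A r + D` and `b |r - M|^(1 + n/2)`. Comparing degrees after squaring gives `n = 2` and `χ ≠ 0`
(`dimension_eq_two`). Then `Tʳᵣ = -D / r⁴`, the preceding case applies, and comparing the two forms
of `f` gives `b = χ`. The converse is a direct computation. -/

namespace ScalarTensor

variable {n : ℕ}

/-! ## Partial derivatives in a static chart -/

/-- A function of the radius and of the base point, read in the space-time chart. -/
def lift (v : ℝ → (Fin n → ℝ) → ℝ) (x : Fin 2 ⊕ Fin n → ℝ) : ℝ :=
  v (x (rIdx n)) (fun i => x (Sum.inr i))

lemma pd_time_lift (v : ℝ → (Fin n → ℝ) → ℝ) (x : Fin 2 ⊕ Fin n → ℝ) :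
    pd (Sum.inl 0) (lift v) x = 0 := by
  simp [pd, lift, rIdx]

lemma pd_radius_lift (v : ℝ → (Fin n → ℝ) → ℝ) (x : Fin 2 ⊕ Fin n → ℝ) :
    pd (Sum.inl 1) (lift v) x = deriv (fun s => v s (fun i => x (Sum.inr i))) (x (rIdx n)) := by
  simp [pd, lift, rIdx]

lemma pd_base_lift (v : ℝ → (Fin n → ℝ) → ℝ) (x : Fin 2 ⊕ Fin n → ℝ) (k : Fin n) :
    pd (Sum.inr k) (lift v) x = pd k (v (x (rIdx n))) (fun i => x (Sum.inr i)) := by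
  have : ∀ s : ℝ, (fun i => Function.update x (Sum.inr k) s (Sum.inr i)) =
      Function.update (fun i => x (Sum.inr i)) k s := by
    intro s; ext i; by_cases hi : i = k
    · subst hi; simp
    · simp [hi]
  simp only [pd, lift, rIdx, this]
  simp

/-- The component formulas below hold only on an open region, where the inverse metric is known;
openness is what lets them be differentiated. -/
lemma pd_congr_of_isOpen {ι : Type} [Fintype ι] [DecidableEq ι] {D : Set (ι → ℝ)} (hD : IsOpen D)
    {u v : (ι → ℝ) → ℝ} (huv : ∀ y ∈ D, u y = v y) {x : ι → ℝ} (hx : x ∈ D) (i : ι) :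
    pd i u x = pd i v x := by
  apply Filter.EventuallyEq.deriv_eq
  have hc : Continuous (fun s => Function.update x i s) := continuous_const.update i continuous_id
  have : ∀ᶠ s in 𝓝 (x i), Function.update x i s ∈ D :=
    hc.continuousAt.eventually_mem (hD.mem_nhds (by simpa using hx))
  filter_upwards [this] with s hs using huv _ hs

lemma isOpen_region {I : Set ℝ} {U : Set (Fin n → ℝ)} (hI : IsOpen I) (hU : IsOpen U) :
    IsOpen (region I U) := by
  apply IsOpen.inter
  · exact hI.preimage (continuous_apply _)
  · exact hU.preimage (by fun_prop)

/-! ## The Levi-Civita connection of a static metric -/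

/-- The components of a static metric as functions of the radius and of the base point. -/
def staticEntry (P Q : ℝ → ℝ) (h : (Fin n → ℝ) → Matrix (Fin n) (Fin n) ℝ) :
    Fin 2 ⊕ Fin n → Fin 2 ⊕ Fin n → ℝ → (Fin n → ℝ) → ℝ
  | Sum.inl a, Sum.inl b, r, _ => if a = b then (if a = 0 then - P r else Q r) else 0
  | Sum.inr i, Sum.inr j, r, θ => r ^ 2 * h θ i j
  | _, _, _, _ => 0

lemma staticMetric_entry (P Q : ℝ → ℝ) (h : (Fin n → ℝ) → Matrix (Fin n) (Fin n) ℝ)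
    (i j : Fin 2 ⊕ Fin n) :
    (fun y => staticMetric P Q h y i j) = lift (staticEntry P Q h i j) := by
  ext y
  rcases i with a | i <;> rcases j with b | j
  · fin_cases a <;> fin_cases b <;> simp [staticMetric, lift, staticEntry]
  all_goals simp [staticMetric, lift, staticEntry]

lemma staticMetric_apply (P Q : ℝ → ℝ) (h : (Fin n → ℝ) → Matrix (Fin n) (Fin n) ℝ)
    (i j : Fin 2 ⊕ Fin n) (y : Fin 2 ⊕ Fin n → ℝ) :
    staticMetric P Q h y i j =
      staticEntry P Q h i j (y (rIdx n)) (fun i => y (Sum.inr i)) :=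
  congrFun (staticMetric_entry P Q h i j) y

/-- The components of the inverse of a static metric. -/
def staticInvEntry (P Q : ℝ → ℝ) (h : (Fin n → ℝ) → Matrix (Fin n) (Fin n) ℝ) :
    Fin 2 ⊕ Fin n → Fin 2 ⊕ Fin n → ℝ → (Fin n → ℝ) → ℝ
  | Sum.inl a, Sum.inl b, r, _ => if a = b then (if a = 0 then - (P r)⁻¹ else (Q r)⁻¹) else 0
  | Sum.inr i, Sum.inr j, r, θ => (r ^ 2)⁻¹ * (h θ)⁻¹ i j
  | _, _, _, _ => 0

lemma staticMetric_inv_apply {P Q : ℝ → ℝ} {h : (Fin n → ℝ) → Matrix (Fin n) (Fin n) ℝ}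
    {x : Fin 2 ⊕ Fin n → ℝ} (hr : x (rIdx n) ≠ 0) (hP : P (x (rIdx n)) ≠ 0)
    (hQ : Q (x (rIdx n)) ≠ 0) (hh : IsUnit (h (fun i => x (Sum.inr i))).det)
    (i j : Fin 2 ⊕ Fin n) :
    (staticMetric P Q h x)⁻¹ i j =
      staticInvEntry P Q h i j (x (rIdx n)) (fun i => x (Sum.inr i)) := by
  have hinv : (staticMetric P Q h x)⁻¹ =
      Matrix.fromBlocks (Matrix.diagonal ![-(P (x (rIdx n)))⁻¹, (Q (x (rIdx n)))⁻¹]) 0 0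
        (((x (rIdx n)) ^ 2)⁻¹ • (h (fun i => x (Sum.inr i)))⁻¹) := by
    apply Matrix.inv_eq_right_inv
    rw [staticMetric, Matrix.fromBlocks_multiply]
    simp only [Matrix.diagonal_mul_diagonal, Matrix.zero_mul, Matrix.mul_zero, add_zero, zero_add,
      Matrix.smul_mul, Matrix.mul_smul, smul_smul, Matrix.mul_nonsing_inv _ hh]
    rw [inv_mul_cancel₀ (pow_ne_zero 2 hr), one_smul, smul_zero, ← Matrix.fromBlocks_one]
    congr 1
    rw [← Matrix.diagonal_one]
    congr 1
    ext a
    fin_cases a <;> simp [hP, hQ]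
  rw [hinv]
  rcases i with a | i <;> rcases j with b | j
  · fin_cases a <;> fin_cases b <;> simp [staticInvEntry]
  all_goals simp [staticInvEntry]

/-- The Christoffel symbols of a static metric as functions of the radius and of the base point. -/
def staticChristoffel (P Q : ℝ → ℝ) (h : (Fin n → ℝ) → Matrix (Fin n) (Fin n) ℝ) :
    Fin 2 ⊕ Fin n → Fin 2 ⊕ Fin n → Fin 2 ⊕ Fin n → ℝ → (Fin n → ℝ) → ℝ
  | Sum.inl a, Sum.inl b, Sum.inl c, r, _ =>
      if a = 0 then (if b = c then 0 else deriv P r / (2 * P r))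
      else if b = c then (if b = 0 then deriv P r / (2 * Q r) else deriv Q r / (2 * Q r)) else 0
  | Sum.inl a, Sum.inr j, Sum.inr k, r, θ => if a = 0 then 0 else -(r / Q r) * h θ j k
  | Sum.inr i, Sum.inl b, Sum.inr k, r, _ => if b = 0 then 0 else if i = k then r⁻¹ else 0
  | Sum.inr i, Sum.inr j, Sum.inl c, r, _ => if c = 0 then 0 else if i = j then r⁻¹ else 0
  | Sum.inr i, Sum.inr j, Sum.inr k, _, θ => christoffel h i j k θ
  | _, _, _, _, _ => 0

lemma pd_const_mul {ι : Type} [Fintype ι] [DecidableEq ι] (c : ℝ) (u : (ι → ℝ) → ℝ) (i : ι)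
    (x : ι → ℝ) : pd i (fun y => c * u y) x = c * pd i u x := by
  simp only [pd, deriv_const_mul_field]

lemma pd_const {ι : Type} [Fintype ι] [DecidableEq ι] (c : ℝ) (i : ι)
    (x : ι → ℝ) : pd i (fun _ => c) x = 0 := by
  simp [pd]

lemma pd_staticEntry_inl_left (P Q : ℝ → ℝ) (h : (Fin n → ℝ) → Matrix (Fin n) (Fin n) ℝ)
    (a : Fin 2) (j : Fin 2 ⊕ Fin n) (k : Fin n) (r : ℝ) (θ : Fin n → ℝ) :
    pd k (staticEntry P Q h (Sum.inl a) j r) θ = 0 := by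
  rcases j with b | j
  · exact pd_const (if a = b then (if a = 0 then - P r else Q r) else 0) k θ
  · exact pd_const 0 k θ

lemma pd_staticEntry_inl_right (P Q : ℝ → ℝ) (h : (Fin n → ℝ) → Matrix (Fin n) (Fin n) ℝ)
    (i k : Fin n) (b : Fin 2) (r : ℝ) (θ : Fin n → ℝ) :
    pd k (staticEntry P Q h (Sum.inr i) (Sum.inl b) r) θ = 0 :=
  pd_const 0 k θ

lemma pd_staticEntry_inr (P Q : ℝ → ℝ) (h : (Fin n → ℝ) → Matrix (Fin n) (Fin n) ℝ)
    (i j k : Fin n) (r : ℝ) (θ : Fin n → ℝ) :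
    pd k (staticEntry P Q h (Sum.inr i) (Sum.inr j) r) θ = r ^ 2 * pd k (fun y => h y i j) θ :=
  pd_const_mul (r ^ 2) (fun y => h y i j) k θ

lemma christoffel_staticMetric {P Q : ℝ → ℝ} {h : (Fin n → ℝ) → Matrix (Fin n) (Fin n) ℝ}
    {x : Fin 2 ⊕ Fin n → ℝ} (hr : x (rIdx n) ≠ 0) (hP : P (x (rIdx n)) ≠ 0)
    (hQ : Q (x (rIdx n)) ≠ 0) (hh : IsUnit (h (fun i => x (Sum.inr i))).det)
    (i j k : Fin 2 ⊕ Fin n) :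
    christoffel (staticMetric P Q h) i j k x =
      staticChristoffel P Q h i j k (x (rIdx n)) (fun i => x (Sum.inr i)) := by
  set r := x (rIdx n) with hrdef
  set θ : Fin n → ℝ := fun i => x (Sum.inr i) with hθ
  have hδ : ∀ i k, ∑ l, (h θ)⁻¹ i l * h θ l k = if i = k then 1 else 0 := by
    intro i k
    have := congrFun (congrFun (Matrix.nonsing_inv_mul (h θ) hh) i) k
    rwa [Matrix.mul_apply, Matrix.one_apply] at this
  -- `∂ᵣ(r² h) = 2 r h`, contracted with the inverse metric, is the source of `Γⁱᵣₖ = δⁱₖ / r`.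
  have hδr : ∀ i k, 2⁻¹ * ∑ l, (r ^ 2)⁻¹ * (h θ)⁻¹ i l * (2 * r * h θ l k) =
      if i = k then r⁻¹ else 0 := by
    intro i k
    have hk : (if i = k then r⁻¹ else 0) = (if i = k then 1 else 0) * r⁻¹ := by simp
    rw [hk, ← hδ, Finset.sum_mul, Finset.mul_sum]
    refine Finset.sum_congr rfl fun l _ => ?_
    field_simp
  simp only [christoffel, staticMetric_entry, staticMetric_inv_apply hr hP hQ hh,
    Fintype.sum_sum_type, Fin.sum_univ_two, ← hrdef, ← hθ]
  rcases i with a | i <;> rcases j with b | j <;> rcases k with c | k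
  · fin_cases a <;> fin_cases b <;> fin_cases c <;>
      simp [pd_time_lift, pd_radius_lift, staticEntry, staticInvEntry, staticChristoffel,
        ← hrdef, ← hθ] <;> field_simp
  · fin_cases a <;> fin_cases b <;>
      simp [pd_time_lift, pd_radius_lift, pd_base_lift, pd_staticEntry_inl_left,
        pd_staticEntry_inl_right, staticEntry, staticInvEntry,
        staticChristoffel, ← hrdef, ← hθ]
  · fin_cases a <;> fin_cases c <;>
      simp [pd_time_lift, pd_radius_lift, pd_base_lift, pd_staticEntry_inl_left,
        pd_staticEntry_inl_right, staticEntry, staticInvEntry,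
        staticChristoffel, ← hrdef, ← hθ]
  · fin_cases a <;>
      simp [pd_time_lift, pd_radius_lift, pd_base_lift, pd_staticEntry_inl_left,
        pd_staticEntry_inl_right, staticEntry, staticInvEntry,
        staticChristoffel, ← hrdef, ← hθ]
    field_simp
  · fin_cases b <;> fin_cases c <;>
      simp [pd_time_lift, pd_radius_lift, pd_base_lift, pd_staticEntry_inl_left,
        pd_staticEntry_inl_right, staticEntry, staticInvEntry,
        staticChristoffel, ← hrdef, ← hθ]
  · fin_cases b <;>
      simp [pd_time_lift, pd_radius_lift, pd_base_lift, pd_staticEntry_inl_left,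
        pd_staticEntry_inl_right, staticEntry, staticInvEntry,
        staticChristoffel, ← hrdef, ← hθ, hδr]
  · fin_cases c <;>
      simp [pd_time_lift, pd_radius_lift, pd_base_lift, pd_staticEntry_inl_left,
        pd_staticEntry_inl_right, staticEntry, staticInvEntry,
        staticChristoffel, ← hrdef, ← hθ, hδr]
  · simp only [pd_base_lift, pd_staticEntry_inr, pd_staticEntry_inl_left, staticInvEntry, staticChristoffel, ← hrdef, ← hθ,
      pd_const_mul, christoffel, zero_mul, zero_add, add_zero]
    congr 1
    refine Finset.sum_congr rfl fun l _ => ?_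
    field_simp

lemma christoffel_symm {U : Set (Fin n → ℝ)} {h : (Fin n → ℝ) → Matrix (Fin n) (Fin n) ℝ}
    (hU : IsOpen U) (hh : ∀ θ ∈ U, (h θ).IsSymm) {θ : Fin n → ℝ} (hθ : θ ∈ U) (i j k : Fin n) :
    christoffel h i j k θ = christoffel h i k j θ := by
  unfold christoffel
  congr 1
  refine Finset.sum_congr rfl fun l _ => ?_
  rw [pd_congr_of_isOpen hU (u := fun y => h y j k) (v := fun y => h y k j)
    (fun y hy => (hh y hy).apply k j) hθ, add_comm (pd j _ θ)]

/-! ## Curvature of a static metric -/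

/-- `P`, `Q` are smooth on the open set `I` of positive radii and `P Q > 0` there. -/
structure IsStaticBackground (I : Set ℝ) (P Q : ℝ → ℝ) : Prop where
  isOpen : IsOpen I
  pos : ∀ r ∈ I, 0 < r
  smooth_P : ContDiffOn ℝ ∞ P I
  smooth_Q : ContDiffOn ℝ ∞ Q I
  lorentzian : ∀ r ∈ I, 0 < P r * Q r

lemma _root_.ContDiffOn.differentiableAt_of_isOpen {f : ℝ → ℝ} {I : Set ℝ}
    (hf : ContDiffOn ℝ ∞ f I) (hI : IsOpen I) {r : ℝ} (hr : r ∈ I) : DifferentiableAt ℝ f r :=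
  (hf.contDiffAt (hI.mem_nhds hr)).differentiableAt (by simp)

lemma _root_.ContDiffOn.deriv_smooth_of_isOpen {f : ℝ → ℝ} {I : Set ℝ}
    (hf : ContDiffOn ℝ ∞ f I) (hI : IsOpen I) : ContDiffOn ℝ ∞ (deriv f) I :=
  hf.deriv_of_isOpen hI (by simp)

namespace IsStaticBackground
variable {I : Set ℝ} {P Q : ℝ → ℝ} {r : ℝ}

lemma P_ne_zero (hb : IsStaticBackground I P Q) (hr : r ∈ I) : P r ≠ 0 :=
  left_ne_zero_of_mul (hb.lorentzian r hr).ne'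

lemma Q_ne_zero (hb : IsStaticBackground I P Q) (hr : r ∈ I) : Q r ≠ 0 :=
  right_ne_zero_of_mul (hb.lorentzian r hr).ne'

lemma ne_zero (hb : IsStaticBackground I P Q) (hr : r ∈ I) : r ≠ 0 := (hb.pos r hr).ne'

end IsStaticBackground

namespace IsConstantCurvatureBase
variable {χ : ℝ} {U : Set (Fin n → ℝ)} {h : (Fin n → ℝ) → Matrix (Fin n) (Fin n) ℝ}
  {θ : Fin n → ℝ}

lemma isUnit_det (hB : IsConstantCurvatureBase χ U h) (hθ : θ ∈ U) : IsUnit (h θ).det :=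
  (hB.posDef θ hθ).det_pos.ne'.isUnit

lemma isSymm (hB : IsConstantCurvatureBase χ U h) (hθ : θ ∈ U) : (h θ).IsSymm := by
  have := (hB.posDef θ hθ).isHermitian
  rwa [Matrix.IsHermitian, Matrix.conjTranspose_eq_transpose_of_trivial] at this

lemma ricci_eq (hB : IsConstantCurvatureBase χ U h) (hθ : θ ∈ U) (j l : Fin n) :
    ricci h j l θ = ((n : ℝ) - 1) * χ * h θ j l := by
  simp only [ricci, hB.curvature θ hθ, if_true, ← Finset.mul_sum, Finset.sum_sub_distrib]
  simp
  ring

end IsConstantCurvatureBase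

lemma christoffel_eq_lift {I : Set ℝ} {P Q : ℝ → ℝ} {χ : ℝ} {U : Set (Fin n → ℝ)}
    {h : (Fin n → ℝ) → Matrix (Fin n) (Fin n) ℝ} (hb : IsStaticBackground I P Q)
    (hB : IsConstantCurvatureBase χ U h) {x : Fin 2 ⊕ Fin n → ℝ} (hx : x ∈ region I U)
    (i j k : Fin 2 ⊕ Fin n) :
    christoffel (staticMetric P Q h) i j k x = lift (staticChristoffel P Q h i j k) x :=
  christoffel_staticMetric (hb.ne_zero hx.1) (hb.P_ne_zero hx.1) (hb.Q_ne_zero hx.1)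
    (hB.isUnit_det hx.2) i j k

lemma pd_christoffel_eq {I : Set ℝ} {P Q : ℝ → ℝ} {χ : ℝ} {U : Set (Fin n → ℝ)}
    {h : (Fin n → ℝ) → Matrix (Fin n) (Fin n) ℝ} (hb : IsStaticBackground I P Q)
    (hB : IsConstantCurvatureBase χ U h) {x : Fin 2 ⊕ Fin n → ℝ} (hx : x ∈ region I U)
    (i j k l : Fin 2 ⊕ Fin n) :
    pd l (christoffel (staticMetric P Q h) i j k) x =
      pd l (lift (staticChristoffel P Q h i j k)) x :=
  pd_congr_of_isOpen (isOpen_region hb.isOpen hB.isOpen)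
    (fun _ hy => christoffel_eq_lift hb hB hy i j k) hx l

/-- The weights of a tensor which is a multiple of the metric on each of the time, radial and
base blocks. -/
def blockWeight (a b c : ℝ) : Fin 2 ⊕ Fin n → ℝ
  | Sum.inl i => if i = 0 then a else b
  | Sum.inr _ => c

/-- `Rᵗₜ` for a static metric. -/
def ricciTime (n : ℕ) (P Q : ℝ → ℝ) (r : ℝ) : ℝ :=
  -(deriv (deriv P) r / (2 * P r * Q r)) + deriv P r / (4 * P r * Q r) *
    (deriv P r / P r + deriv Q r / Q r) - n * deriv P r / (2 * r * P r * Q r)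

/-- `Rʳᵣ` for a static metric. -/
def ricciRadius (n : ℕ) (P Q : ℝ → ℝ) (r : ℝ) : ℝ :=
  -(deriv (deriv P) r / (2 * P r * Q r)) + deriv P r / (4 * P r * Q r) *
    (deriv P r / P r + deriv Q r / Q r) + n * deriv Q r / (2 * r * Q r ^ 2)

/-- The eigenvalue of the mixed Ricci tensor on the base directions for a static metric. -/
def ricciBase (n : ℕ) (χ : ℝ) (P Q : ℝ → ℝ) (r : ℝ) : ℝ :=
  (((n : ℝ) - 1) * (χ - 1 / Q r) - r / (2 * Q r) * (deriv P r / P r - deriv Q r / Q r)) / r ^ 2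

lemma pd_staticChristoffel_inl (P Q : ℝ → ℝ) (h : (Fin n → ℝ) → Matrix (Fin n) (Fin n) ℝ)
    (i : Fin 2 ⊕ Fin n) (a b : Fin 2) (k : Fin n) (r : ℝ) (θ : Fin n → ℝ) :
    pd k (staticChristoffel P Q h i (Sum.inl a) (Sum.inl b) r) θ = 0 := by
  rcases i with c | i
  · exact pd_const (staticChristoffel P Q h (Sum.inl c) (Sum.inl a) (Sum.inl b) r 0) k θ
  · exact pd_const 0 k θ

lemma pd_staticChristoffel_inl_inr (P Q : ℝ → ℝ) (h : (Fin n → ℝ) → Matrix (Fin n) (Fin n) ℝ)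
    (i : Fin 2 ⊕ Fin n) (a : Fin 2) (j k : Fin n) (r : ℝ) (θ : Fin n → ℝ) :
    pd k (staticChristoffel P Q h i (Sum.inl a) (Sum.inr j) r) θ = 0 := by
  rcases i with c | i
  · exact pd_const 0 k θ
  · exact pd_const (staticChristoffel P Q h (Sum.inr i) (Sum.inl a) (Sum.inr j) r 0) k θ

lemma pd_staticChristoffel_inr_inl (P Q : ℝ → ℝ) (h : (Fin n → ℝ) → Matrix (Fin n) (Fin n) ℝ)
    (i : Fin 2 ⊕ Fin n) (a : Fin 2) (j k : Fin n) (r : ℝ) (θ : Fin n → ℝ) :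
    pd k (staticChristoffel P Q h i (Sum.inr j) (Sum.inl a) r) θ = 0 := by
  rcases i with c | i
  · exact pd_const 0 k θ
  · exact pd_const (staticChristoffel P Q h (Sum.inr i) (Sum.inr j) (Sum.inl a) r 0) k θ

lemma pd_staticChristoffel_inr (P Q : ℝ → ℝ) (h : (Fin n → ℝ) → Matrix (Fin n) (Fin n) ℝ)
    (i j k l : Fin n) (r : ℝ) (θ : Fin n → ℝ) :
    pd l (staticChristoffel P Q h (Sum.inr i) (Sum.inr j) (Sum.inr k) r) θ =
      pd l (christoffel h i j k) θ := rfl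

section
variable {I : Set ℝ} {P Q : ℝ → ℝ} {χ : ℝ} {U : Set (Fin n → ℝ)}
    {h : (Fin n → ℝ) → Matrix (Fin n) (Fin n) ℝ}

/-- The base interacts with the `(t, r)` plane only through `Γⁱᵣₖ = δⁱₖ / r` and `Γʳᵢⱼ = -(r/Q)
hᵢⱼ`. The base block is therefore the base Ricci tensor `(n - 1) χ h` plus further multiples of `h`.
-/
lemma ricci_staticMetric (hb : IsStaticBackground I P Q)
    (hB : IsConstantCurvatureBase χ U h) {x : Fin 2 ⊕ Fin n → ℝ} (hx : x ∈ region I U)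
    (i j : Fin 2 ⊕ Fin n) :
    ricci (staticMetric P Q h) i j x =
      blockWeight (ricciTime n P Q (x (rIdx n))) (ricciRadius n P Q (x (rIdx n)))
        (ricciBase n χ P Q (x (rIdx n))) i * staticMetric P Q h x i j := by
  have hr0 := hb.ne_zero hx.1
  have hP0 := hb.P_ne_zero hx.1
  have hQ0 := hb.Q_ne_zero hx.1
  have hP := (hb.smooth_P.differentiableAt_of_isOpen hb.isOpen hx.1).hasDerivAt
  have hQ := (hb.smooth_Q.differentiableAt_of_isOpen hb.isOpen hx.1).hasDerivAt
  have hP' := ((hb.smooth_P.deriv_smooth_of_isOpen hb.isOpen).differentiableAt_of_isOpen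
    hb.isOpen hx.1).hasDerivAt
  have hθU := hx.2
  simp only [ricci, riemann, pd_christoffel_eq hb hB hx, christoffel_eq_lift hb hB hx]
  rw [staticMetric_apply]
  simp only [lift]
  set r := x (rIdx n) with hrdef
  set θ : Fin n → ℝ := fun i => x (Sum.inr i) with hθ
  have hd1 : deriv (fun s => deriv P s / (2 * P s)) r =
      (deriv (deriv P) r * (2 * P r) - deriv P r * (2 * deriv P r)) / (2 * P r) ^ 2 :=
    (hP'.fun_div (hP.const_mul 2) (by simpa using hP0)).deriv
  have hd2 : deriv (fun s => deriv P s / (2 * Q s)) r =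
      (deriv (deriv P) r * (2 * Q r) - deriv P r * (2 * deriv Q r)) / (2 * Q r) ^ 2 :=
    (hP'.fun_div (hQ.const_mul 2) (by simpa using hQ0)).deriv
  have hd3 : deriv (fun s => s / Q s) r = (1 * Q r - r * deriv Q r) / Q r ^ 2 :=
    ((hasDerivAt_id r).fun_div hQ hQ0).deriv
  have hd4 : deriv (fun s : ℝ => s⁻¹) r = -(r ^ 2)⁻¹ := (hasDerivAt_inv hr0).deriv
  have hsymm : ∀ i j k, christoffel h i j k θ = christoffel h i k j θ :=
    christoffel_symm hB.isOpen (fun _ h => hB.isSymm h) hθU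
  rcases i with a | i <;> rcases j with b | j
  · fin_cases a <;> fin_cases b <;>
      simp [Fintype.sum_sum_type, Fin.sum_univ_two, pd_time_lift, pd_radius_lift, pd_base_lift,
        pd_staticChristoffel_inl, pd_staticChristoffel_inl_inr, pd_staticChristoffel_inr_inl,
        pd_staticChristoffel_inr, staticEntry, staticChristoffel, ← hrdef, ← hθ, hd1, hd2, hd3,
        hd4, blockWeight, ricciTime, ricciRadius]
    · field_simp
      ring
    · field_simp
      ring
  · fin_cases a <;>
      simp [Fintype.sum_sum_type, Fin.sum_univ_two, pd_time_lift, pd_radius_lift, pd_base_lift,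
        pd_staticChristoffel_inl, pd_staticChristoffel_inl_inr, pd_staticChristoffel_inr_inl,
        pd_staticChristoffel_inr, staticEntry, staticChristoffel, ← hrdef, ← hθ, hd1, hd2, hd3,
        hd4, blockWeight, ricciTime, ricciRadius]
    simp only [hsymm _ j, sub_self]
  · fin_cases b <;>
      simp [Fintype.sum_sum_type, Fin.sum_univ_two, pd_time_lift, pd_radius_lift, pd_base_lift,
        pd_staticChristoffel_inl, pd_staticChristoffel_inl_inr, pd_staticChristoffel_inr_inl,
        pd_staticChristoffel_inr, staticEntry, staticChristoffel, ← hrdef, ← hθ, hd1, hd2, hd3,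
        hd4, blockWeight, ricciTime, ricciRadius]
    simp only [mul_comm, sub_self]
  · have hric := hB.ricci_eq hθU i j
    simp only [ricci, riemann] at hric
    simp [Fintype.sum_sum_type, Fin.sum_univ_two, pd_time_lift, pd_radius_lift, pd_base_lift,
        pd_staticChristoffel_inl, pd_staticChristoffel_inl_inr, pd_staticChristoffel_inr_inl,
        pd_staticChristoffel_inr, staticEntry, staticChristoffel, ← hrdef, ← hθ, hd1, hd2, hd3,
        hd4, blockWeight, ricciBase]
    rw [(hB.isSymm hθU).apply i j]
    -- The summand of the base Ricci tensor, known from `hric`, is separated from the terms created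
    -- by the factor `r²`.
    have hsum : ∀ x, (pd x (christoffel h x j i) θ - pd j (christoffel h x x i) θ +
          (-(r⁻¹ * (r / Q r * h θ i j)) +
            ∑ y, christoffel h x x y θ * christoffel h y j i θ -
            ((-if x = j then r⁻¹ * (r / Q r * h θ x i) else 0) +
              ∑ y, christoffel h x j y θ * christoffel h y x i θ))) =
        (pd x (christoffel h x j i) θ - pd j (christoffel h x x i) θ +
          ∑ y, (christoffel h x x y θ * christoffel h y j i θ -
            christoffel h x j y θ * christoffel h y x i θ)) +
          (-(r⁻¹ * (r / Q r * h θ i j)) + if x = j then r⁻¹ * (r / Q r * h θ x i) else 0) := by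
      intro x
      rw [Finset.sum_sub_distrib]
      ring
    rw [Finset.sum_congr rfl fun x _ => hsum x, Finset.sum_add_distrib, hric,
      Finset.sum_add_distrib]
    simp only [Finset.sum_ite_eq', Finset.mem_univ, if_true, Finset.sum_const, Finset.card_univ,
      Fintype.card_fin, nsmul_eq_mul, (hB.isSymm hθU).apply i j, hd3]
    field_simp
    ring
end

/-! ## Reduction of the field equations to the radial coordinate -/

/-- Raising an index leaves the block weights on the diagonal; all mixed components and traces below
come from this. -/
lemma sum_inv_mul_blockWeight {P Q : ℝ → ℝ} {h : (Fin n → ℝ) → Matrix (Fin n) (Fin n) ℝ}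
    {x : Fin 2 ⊕ Fin n → ℝ} (hr : x (rIdx n) ≠ 0) (hP : P (x (rIdx n)) ≠ 0)
    (hQ : Q (x (rIdx n)) ≠ 0) (hh : IsUnit (h (fun i => x (Sum.inr i))).det) (a b c : ℝ)
    (i j : Fin 2 ⊕ Fin n) :
    ∑ k, (staticMetric P Q h x)⁻¹ i k * (blockWeight a b c k * staticMetric P Q h x k j) =
      if i = j then blockWeight a b c i else 0 := by
  simp only [staticMetric_apply, staticMetric_inv_apply hr hP hQ hh, Fintype.sum_sum_type,
    Fin.sum_univ_two]
  set r := x (rIdx n) with hrdef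
  set θ : Fin n → ℝ := fun i => x (Sum.inr i) with hθ
  rcases i with d | i <;> rcases j with e | j
  · fin_cases d <;> fin_cases e <;> simp [staticEntry, staticInvEntry, blockWeight] <;> field_simp
  · simp [staticEntry, staticInvEntry]
  · simp [staticEntry, staticInvEntry]
  · have hδ := congrFun (congrFun (Matrix.nonsing_inv_mul (h θ) hh) i) j
    rw [Matrix.mul_apply, Matrix.one_apply] at hδ
    have hc : (if (Sum.inr i : Fin 2 ⊕ Fin n) = Sum.inr j then
        (blockWeight a b c (Sum.inr i : Fin 2 ⊕ Fin n)) else 0) =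
        (if i = j then 1 else 0) * c := by simp [blockWeight]
    rw [hc, ← hδ, Finset.sum_mul]
    simp only [staticEntry, staticInvEntry, blockWeight, zero_mul, mul_zero, zero_add]
    refine Finset.sum_congr rfl fun l _ => ?_
    field_simp

lemma staticMetric_symm {P Q : ℝ → ℝ} {h : (Fin n → ℝ) → Matrix (Fin n) (Fin n) ℝ}
    {x : Fin 2 ⊕ Fin n → ℝ} (hh : (h (fun i => x (Sum.inr i))).IsSymm) (i j : Fin 2 ⊕ Fin n) :
    staticMetric P Q h x i j = staticMetric P Q h x j i := by
  rcases i with d | i <;> rcases j with e | j <;> simp [staticMetric]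
  · rw [Matrix.diagonal_apply, Matrix.diagonal_apply]
    split_ifs <;> simp_all
  · exact Or.inl (hh.apply j i)

/-- A nonzero entry of the metric has indices of equal weight, so the weight may be attached to
either one. -/
lemma blockWeight_mul_staticMetric {P Q : ℝ → ℝ} {h : (Fin n → ℝ) → Matrix (Fin n) (Fin n) ℝ}
    (x : Fin 2 ⊕ Fin n → ℝ) (a b c : ℝ) (i j : Fin 2 ⊕ Fin n) :
    blockWeight a b c i * staticMetric P Q h x i j =
      blockWeight a b c j * staticMetric P Q h x i j := by
  rcases i with d | i <;> rcases j with e | j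
  · by_cases hde : d = e
    · rw [hde]
    · simp [staticMetric, Matrix.diagonal_apply_ne _ hde]
  all_goals simp [staticMetric, blockWeight]

lemma sum_blockWeight (a b c : ℝ) :
    ∑ i : Fin 2 ⊕ Fin n, blockWeight a b c i = a + b + n * c := by
  simp [Fintype.sum_sum_type, blockWeight]

lemma trace_blockWeight {P Q : ℝ → ℝ} {h : (Fin n → ℝ) → Matrix (Fin n) (Fin n) ℝ}
    {x : Fin 2 ⊕ Fin n → ℝ} (hr : x (rIdx n) ≠ 0) (hP : P (x (rIdx n)) ≠ 0)
    (hQ : Q (x (rIdx n)) ≠ 0) (hh : IsUnit (h (fun i => x (Sum.inr i))).det)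
    (hs : (h (fun i => x (Sum.inr i))).IsSymm) (a b c : ℝ) :
    ∑ i, ∑ j, (staticMetric P Q h x)⁻¹ i j * (blockWeight a b c i * staticMetric P Q h x i j) =
      a + b + n * c := by
  rw [← sum_blockWeight]
  refine Finset.sum_congr rfl fun i _ => ?_
  have := sum_inv_mul_blockWeight hr hP hQ hh a b c i i
  rw [if_pos rfl] at this
  refine Eq.trans (Finset.sum_congr rfl fun j _ => ?_) this
  rw [blockWeight_mul_staticMetric, staticMetric_symm hs]

lemma pd_radial (u : ℝ → ℝ) (j : Fin 2 ⊕ Fin n) :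
    pd j (radial n u) = radial n (fun r => if j = rIdx n then deriv u r else 0) := by
  funext x
  change pd j (lift (fun r _ => u r)) x = _
  rcases j with b | j
  · fin_cases b
    · simp [pd_time_lift, radial, rIdx]
    · simp [pd_radius_lift, radial, rIdx]
  · rw [pd_base_lift]
    simp [radial, rIdx, pd]

/-- `∇ᵗ∇ₜ u` for a radial function in a static metric. -/
def hessTime (P Q u : ℝ → ℝ) (r : ℝ) : ℝ := deriv P r * deriv u r / (2 * P r * Q r)

/-- `∇ʳ∇ᵣ u` for a radial function in a static metric. -/
def hessRadius (Q u : ℝ → ℝ) (r : ℝ) : ℝ :=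
  (deriv (deriv u) r - deriv Q r / (2 * Q r) * deriv u r) / Q r

/-- The eigenvalue of the mixed Hessian of a radial function on the base directions. -/
def hessBase (Q u : ℝ → ℝ) (r : ℝ) : ℝ := deriv u r / (r * Q r)

/-- `∇²u` for a radial function in a static metric. -/
def boxRadial (n : ℕ) (P Q u : ℝ → ℝ) (r : ℝ) : ℝ :=
  hessTime P Q u r + hessRadius Q u r + n * hessBase Q u r

/-- The scalar curvature of a static metric. -/
def scalarRadial (n : ℕ) (χ : ℝ) (P Q : ℝ → ℝ) (r : ℝ) : ℝ :=
  ricciTime n P Q r + ricciRadius n P Q r + n * ricciBase n χ P Q r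

/-- `(∇u)²` for a radial function in a static metric. -/
def gradSqRadial (Q u : ℝ → ℝ) (r : ℝ) : ℝ := deriv u r ^ 2 / Q r

/-- `Tᵗₜ` for a radial scalar field in a static metric. -/
def stressTime (n : ℕ) (F P Q φ : ℝ → ℝ) (r : ℝ) : ℝ :=
  (F (φ r))⁻¹ * (hessTime P Q (fun s => F (φ s)) r - boxRadial n P Q (fun s => F (φ s)) r -
    1 / 2 * gradSqRadial Q φ r)

/-- `Tʳᵣ` for a radial scalar field in a static metric. -/
def stressRadius (n : ℕ) (F P Q φ : ℝ → ℝ) (r : ℝ) : ℝ :=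
  (F (φ r))⁻¹ * (hessRadius Q (fun s => F (φ s)) r - boxRadial n P Q (fun s => F (φ s)) r +
    1 / 2 * gradSqRadial Q φ r)

/-- The eigenvalue of the mixed energy-momentum tensor on the base directions. -/
def stressBase (n : ℕ) (F P Q φ : ℝ → ℝ) (r : ℝ) : ℝ :=
  (F (φ r))⁻¹ * (hessBase Q (fun s => F (φ s)) r - boxRadial n P Q (fun s => F (φ s)) r -
    1 / 2 * gradSqRadial Q φ r)

section
variable {I : Set ℝ} {P Q : ℝ → ℝ} {χ : ℝ} {U : Set (Fin n → ℝ)}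
    {h : (Fin n → ℝ) → Matrix (Fin n) (Fin n) ℝ} {x : Fin 2 ⊕ Fin n → ℝ}

lemma hessian_radial (hb : IsStaticBackground I P Q)
    (hB : IsConstantCurvatureBase χ U h) (hx : x ∈ region I U) (u : ℝ → ℝ)
    (i j : Fin 2 ⊕ Fin n) :
    hessian (staticMetric P Q h) (radial n u) i j x =
      blockWeight (hessTime P Q u (x (rIdx n))) (hessRadius Q u (x (rIdx n)))
        (hessBase Q u (x (rIdx n))) i * staticMetric P Q h x i j := by
  have hr0 := hb.ne_zero hx.1
  have hP0 := hb.P_ne_zero hx.1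
  have hQ0 := hb.Q_ne_zero hx.1
  rw [staticMetric_apply]
  simp only [hessian, pd_radial, christoffel_eq_lift hb hB hx, lift, radial]
  set r := x (rIdx n) with hrdef
  simp only [Fintype.sum_sum_type, Fin.sum_univ_two, rIdx]
  rcases i with a | i <;> rcases j with b | j
  · fin_cases a <;> fin_cases b <;>
      simp [staticChristoffel, staticEntry, blockWeight, hessTime, hessRadius] <;> field_simp
  · simp [staticChristoffel, staticEntry, blockWeight]
  · simp [staticChristoffel, staticEntry, blockWeight]
  · simp [staticChristoffel, staticEntry, blockWeight, hessBase]
    field_simp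

lemma scalarCurvature_staticMetric (hb : IsStaticBackground I P Q)
    (hB : IsConstantCurvatureBase χ U h) (hx : x ∈ region I U) :
    scalarCurvature (staticMetric P Q h) x = scalarRadial n χ P Q (x (rIdx n)) := by
  simp only [scalarCurvature, ricci_staticMetric hb hB hx]
  exact trace_blockWeight (hb.ne_zero hx.1) (hb.P_ne_zero hx.1) (hb.Q_ne_zero hx.1)
    (hB.isUnit_det hx.2) (hB.isSymm hx.2) _ _ _

lemma box_radial (hb : IsStaticBackground I P Q)
    (hB : IsConstantCurvatureBase χ U h) (hx : x ∈ region I U) (u : ℝ → ℝ) :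
    box (staticMetric P Q h) (radial n u) x = boxRadial n P Q u (x (rIdx n)) := by
  simp only [box, hessian_radial hb hB hx]
  exact trace_blockWeight (hb.ne_zero hx.1) (hb.P_ne_zero hx.1) (hb.Q_ne_zero hx.1)
    (hB.isUnit_det hx.2) (hB.isSymm hx.2) _ _ _

lemma gradSq_radial (hb : IsStaticBackground I P Q)
    (hB : IsConstantCurvatureBase χ U h) (hx : x ∈ region I U) (u : ℝ → ℝ) :
    gradSq (staticMetric P Q h) (radial n u) x = gradSqRadial Q u (x (rIdx n)) := by
  simp only [gradSq, pd_radial, staticMetric_inv_apply (hb.ne_zero hx.1) (hb.P_ne_zero hx.1)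
    (hb.Q_ne_zero hx.1) (hB.isUnit_det hx.2)]
  simp [Fintype.sum_sum_type, Fin.sum_univ_two, radial, rIdx, staticInvEntry, gradSqRadial]
  ring

lemma stress_radial (hb : IsStaticBackground I P Q)
    (hB : IsConstantCurvatureBase χ U h) (hx : x ∈ region I U) (F φ : ℝ → ℝ)
    (i j : Fin 2 ⊕ Fin n) :
    stress F (staticMetric P Q h) (radial n φ) i j x =
      blockWeight (stressTime n F P Q φ (x (rIdx n))) (stressRadius n F P Q φ (x (rIdx n)))
        (stressBase n F P Q φ (x (rIdx n))) i * staticMetric P Q h x i j := by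
  have hQ0 := hb.Q_ne_zero hx.1
  change (F (radial n φ x))⁻¹ * (hessian (staticMetric P Q h) (radial n (fun s => F (φ s))) i j x
    + pd i (radial n φ) x * pd j (radial n φ) x
    - staticMetric P Q h x i j * box (staticMetric P Q h) (radial n (fun s => F (φ s))) x
    - (1 / 2) * staticMetric P Q h x i j * gradSq (staticMetric P Q h) (radial n φ) x) = _
  rw [hessian_radial hb hB hx, box_radial hb hB hx, gradSq_radial hb hB hx, staticMetric_apply]
  simp only [pd_radial, radial]
  set r := x (rIdx n) with hrdef
  simp only [rIdx]
  rcases i with a | i <;> rcases j with b | j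
  · fin_cases a <;> fin_cases b <;>
      simp [staticEntry, blockWeight, stressTime, stressRadius]
    · ring
    · rw [gradSqRadial]
      field_simp
      ring
  · simp [staticEntry]
  · simp [staticEntry]
  · simp [staticEntry, blockWeight, stressBase]
    ring

lemma einstein_staticMetric (hb : IsStaticBackground I P Q)
    (hB : IsConstantCurvatureBase χ U h) (hx : x ∈ region I U) (i j : Fin 2 ⊕ Fin n) :
    einstein (staticMetric P Q h) i j x =
      blockWeight (ricciTime n P Q (x (rIdx n)) - 1 / 2 * scalarRadial n χ P Q (x (rIdx n)))
        (ricciRadius n P Q (x (rIdx n)) - 1 / 2 * scalarRadial n χ P Q (x (rIdx n)))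
        (ricciBase n χ P Q (x (rIdx n)) - 1 / 2 * scalarRadial n χ P Q (x (rIdx n))) i *
        staticMetric P Q h x i j := by
  rw [einstein, ricci_staticMetric hb hB hx, scalarCurvature_staticMetric hb hB hx]
  rcases i with a | i
  · fin_cases a <;> simp [blockWeight] <;> ring
  · simp [blockWeight]
    ring

lemma mixedStress_radial (hb : IsStaticBackground I P Q)
    (hB : IsConstantCurvatureBase χ U h) (hx : x ∈ region I U) (F φ : ℝ → ℝ)
    (i : Fin 2 ⊕ Fin n) :
    mixedStress F (staticMetric P Q h) (radial n φ) i i x =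
      blockWeight (stressTime n F P Q φ (x (rIdx n))) (stressRadius n F P Q φ (x (rIdx n)))
        (stressBase n F P Q φ (x (rIdx n))) i := by
  simp only [mixedStress, stress_radial hb hB hx]
  rw [sum_inv_mul_blockWeight (hb.ne_zero hx.1) (hb.P_ne_zero hx.1) (hb.Q_ne_zero hx.1)
    (hB.isUnit_det hx.2), if_pos rfl]

lemma exists_mem_region (hB : IsConstantCurvatureBase χ U h) {r : ℝ} (hr : r ∈ I) :
    ∃ x ∈ region I U, x (rIdx n) = r := by
  obtain ⟨θ, hθ⟩ := hB.nonempty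
  exact ⟨Sum.elim ![0, r] θ, ⟨by simpa [rIdx] using hr, by simpa using hθ⟩, by simp [rIdx]⟩

lemma forall_mem_region_iff (hB : IsConstantCurvatureBase χ U h) (p : ℝ → Prop) :
    (∀ x ∈ region I U, p (x (rIdx n))) ↔ ∀ r ∈ I, p r := by
  refine ⟨fun H r hr => ?_, fun H x hx => H _ hx.1⟩
  obtain ⟨x, hx, rfl⟩ := exists_mem_region hB hr
  exact H x hx

/-- The field equations for a radial scalar field in a static metric, in the radial coordinate. -/
def RadialFieldEquations (n : ℕ) (χ : ℝ) (F P Q φ : ℝ → ℝ) (r : ℝ) : Prop :=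
  ricciTime n P Q r - 1 / 2 * scalarRadial n χ P Q r = stressTime n F P Q φ r ∧
  ricciRadius n P Q r - 1 / 2 * scalarRadial n χ P Q r = stressRadius n F P Q φ r ∧
  ricciBase n χ P Q r - 1 / 2 * scalarRadial n χ P Q r = stressBase n F P Q φ r ∧
  boxRadial n P Q φ r = -(1 / 2) * deriv F (φ r) * scalarRadial n χ P Q r

/-- Each block has a nonvanishing diagonal entry of the metric, from which its weight is read off;
`1 ≤ n` provides one in the base block. -/
lemma blockWeight_congr_iff (hn : 1 ≤ n) (hb : IsStaticBackground I P Q)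
    (hB : IsConstantCurvatureBase χ U h) (hx : x ∈ region I U) (a b c a' b' c' : ℝ) :
    (∀ i j, blockWeight a b c i * staticMetric P Q h x i j =
      blockWeight a' b' c' i * staticMetric P Q h x i j) ↔ a = a' ∧ b = b' ∧ c = c' := by
  refine ⟨fun H => ⟨?_, ?_, ?_⟩, fun ⟨ha, hb, hc⟩ i j => by rw [ha, hb, hc]⟩
  · have := H (Sum.inl 0) (Sum.inl 0)
    simpa [staticMetric, blockWeight, hb.P_ne_zero hx.1] using this
  · have := H (Sum.inl 1) (Sum.inl 1)
    simpa [staticMetric, blockWeight, hb.Q_ne_zero hx.1] using this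
  · have := H (Sum.inr ⟨0, hn⟩) (Sum.inr ⟨0, hn⟩)
    simpa [staticMetric, blockWeight, hb.ne_zero hx.1, ((hB.posDef _ hx.2).diag_pos).ne']
      using this

lemma fieldEquations_iff (hn : 1 ≤ n) (hb : IsStaticBackground I P Q)
    (hB : IsConstantCurvatureBase χ U h) (F φ : ℝ → ℝ) :
    FieldEquations F (staticMetric P Q h) (radial n φ) (region I U) ↔
      ∀ r ∈ I, RadialFieldEquations n χ F P Q φ r := by
  rw [← forall_mem_region_iff hB]
  refine forall₂_congr fun x hx => ?_
  simp only [einstein_staticMetric hb hB hx, stress_radial hb hB hx, box_radial hb hB hx,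
    scalarCurvature_staticMetric hb hB hx, blockWeight_congr_iff hn hb hB hx, and_assoc]
  rfl

lemma radialEqTime_iff (hb : IsStaticBackground I P Q)
    (hB : IsConstantCurvatureBase χ U h) (F φ : ℝ → ℝ) :
    RadialEqTime F (staticMetric P Q h) (radial n φ) (region I U) ↔
      ∀ r ∈ I, stressRadius n F P Q φ r = stressTime n F P Q φ r := by
  rw [← forall_mem_region_iff hB]
  refine forall₂_congr fun x hx => ?_
  simp [mixedStress_radial hb hB hx, blockWeight, rIdx, tIdx]

lemma angularEqMul_iff (hn : 1 ≤ n) (hb : IsStaticBackground I P Q)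
    (hB : IsConstantCurvatureBase χ U h) (F φ : ℝ → ℝ) (k : ℝ) :
    AngularEqMul F (staticMetric P Q h) (radial n φ) (region I U) k ↔
      ∀ r ∈ I, stressBase n F P Q φ r = k * stressRadius n F P Q φ r := by
  have : Nonempty (Fin n) := ⟨⟨0, hn⟩⟩
  rw [← forall_mem_region_iff hB]
  refine forall₂_congr fun x hx => ?_
  simp [mixedStress_radial hb hB hx, blockWeight, rIdx]

lemma radialEqPower_iff (hb : IsStaticBackground I P Q)
    (hB : IsConstantCurvatureBase χ U h) (F φ : ℝ → ℝ) (C : ℝ) (p : ℕ) :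
    RadialEqPower F (staticMetric P Q h) (radial n φ) (region I U) C p ↔
      ∀ r ∈ I, stressRadius n F P Q φ r = C / r ^ p := by
  rw [← forall_mem_region_iff hB]
  refine forall₂_congr fun x hx => ?_
  simp [mixedStress_radial hb hB hx, blockWeight, rIdx]
end

/-! ## General coupling functions -/

/-- Source of all the first integrals below. -/
lemma exists_eq_of_hasDerivAt_zero {I : Set ℝ} (hI : IsOpen I) (hc : I.OrdConnected) {f : ℝ → ℝ}
    (hf : ∀ r ∈ I, HasDerivAt f 0 r) : ∃ c, ∀ r ∈ I, f r = c :=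
  hI.exists_is_const_of_deriv_eq_zero hc.isPreconnected
    (fun r hr => (hf r hr).differentiableAt.differentiableWithinAt) (fun r hr => (hf r hr).deriv)

section
variable {I : Set ℝ} {P Q φ F : ℝ → ℝ} {χ r : ℝ}

lemma hasDerivAt_of_smooth {f : ℝ → ℝ} (hf : ContDiffOn ℝ ∞ f I) (hI : IsOpen I) (hr : r ∈ I) :
    HasDerivAt f (deriv f r) r :=
  (hf.differentiableAt_of_isOpen hI hr).hasDerivAt

lemma hasDerivAt_deriv_of_smooth {f : ℝ → ℝ} (hf : ContDiffOn ℝ ∞ f I) (hI : IsOpen I)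
    (hr : r ∈ I) : HasDerivAt (deriv f) (deriv (deriv f) r) r :=
  hasDerivAt_of_smooth (hf.deriv_smooth_of_isOpen hI) hI hr

/-- The coupling function is smooth only at the points `φ r`; being `C²` near such a point is enough
to differentiate `deriv F` there. -/
lemma hasDerivAt_deriv_of_contDiffAt {f : ℝ → ℝ} (hf : ContDiffAt ℝ ∞ f r) :
    HasDerivAt (deriv f) (deriv (deriv f) r) r := by
  have h2 : ContDiffAt ℝ 2 f r := mod_cast contDiffAt_infty.1 hf 2
  obtain ⟨u, hu, hfu⟩ := h2.contDiffOn le_rfl (by simp)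
  obtain ⟨v, hvu, hv, hrv⟩ := mem_nhds_iff.1 hu
  have h1 : ContDiffOn ℝ 1 (deriv f) v :=
    (hfu.mono hvu).deriv_of_isOpen hv (by norm_num)
  exact ((h1.contDiffAt (hv.mem_nhds hrv)).differentiableAt (by simp)).hasDerivAt

lemma deriv_comp_eq (hI : IsOpen I) (hφ : ContDiffOn ℝ ∞ φ I)
    (hF : ∀ r ∈ I, ContDiffAt ℝ ∞ F (φ r)) (hr : r ∈ I) :
    deriv (fun s => F (φ s)) r = deriv F (φ r) * deriv φ r :=
  ((((hF r hr).differentiableAt (by simp)).hasDerivAt).comp r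
    (hasDerivAt_of_smooth hφ hI hr)).deriv

lemma deriv_deriv_comp_eq (hI : IsOpen I) (hφ : ContDiffOn ℝ ∞ φ I)
    (hF : ∀ r ∈ I, ContDiffAt ℝ ∞ F (φ r)) (hr : r ∈ I) :
    deriv (deriv (fun s => F (φ s))) r =
      deriv (deriv F) (φ r) * deriv φ r ^ 2 + deriv F (φ r) * deriv (deriv φ) r := by
  have heq : deriv (fun s => F (φ s)) =ᶠ[𝓝 r] fun s => deriv F (φ s) * deriv φ s := by
    filter_upwards [hI.mem_nhds hr] with s hs using deriv_comp_eq hI hφ hF hs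
  rw [heq.deriv_eq]
  have h1 : HasDerivAt (fun s => deriv F (φ s)) (deriv (deriv F) (φ r) * deriv φ r) r :=
    (hasDerivAt_deriv_of_contDiffAt (hF r hr)).comp r (hasDerivAt_of_smooth hφ hI hr)
  rw [(h1.fun_mul (hasDerivAt_deriv_of_smooth hφ hI hr)).deriv]
  ring

lemma boxRadial_comp (n : ℕ) (hb : IsStaticBackground I P Q) (hφ : ContDiffOn ℝ ∞ φ I)
    (hF : ∀ r ∈ I, ContDiffAt ℝ ∞ F (φ r)) (hr : r ∈ I) :
    boxRadial n P Q (fun s => F (φ s)) r =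
      deriv F (φ r) * boxRadial n P Q φ r + deriv (deriv F) (φ r) * gradSqRadial Q φ r := by
  simp only [boxRadial, hessTime, hessRadius, hessBase, gradSqRadial,
    deriv_comp_eq hb.isOpen hφ hF hr, deriv_deriv_comp_eq hb.isOpen hφ hF hr]
  ring

/-- Add the time equation, the radial one and `n` times the base one. The Einstein tensor has trace
`-(n/2) R`, the stress tensor `F⁻¹ (-(n + 1) ∇²F(φ) - (n/2) (∇φ)²)`; the chain rule and the scalar
equation then eliminate `∇²F(φ)`. -/
lemma RadialFieldEquations.trace (hb : IsStaticBackground I P Q) (hφ : ContDiffOn ℝ ∞ φ I)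
    (hF : ∀ r ∈ I, ContDiffAt ℝ ∞ F (φ r)) (hF0 : F (φ r) ≠ 0) (hr : r ∈ I)
    (hfe : RadialFieldEquations n χ F P Q φ r) :
    ((n : ℝ) / 2 * F (φ r) + ((n : ℝ) + 1) / 2 * deriv F (φ r) ^ 2) * scalarRadial n χ P Q r =
      ((n : ℝ) / 2 + ((n : ℝ) + 1) * deriv (deriv F) (φ r)) * gradSqRadial Q φ r := by
  obtain ⟨h1, h2, h3, h4⟩ := hfe
  have hbox := boxRadial_comp n hb hφ hF hr
  have hB : boxRadial n P Q (fun s => F (φ s)) r = hessTime P Q (fun s => F (φ s)) r +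
    hessRadius Q (fun s => F (φ s)) r + n * hessBase Q (fun s => F (φ s)) r := rfl
  have hS : scalarRadial n χ P Q r =
    ricciTime n P Q r + ricciRadius n P Q r + n * ricciBase n χ P Q r := rfl
  simp only [stressTime, stressRadius, stressBase] at h1 h2 h3
  rw [eq_inv_mul_iff_mul_eq₀ hF0] at h1 h2 h3
  rw [h4] at hbox
  linear_combination (-1) * h1 - h2 - n * h3 - F (φ r) * hS + hB + (n + 1) * hbox

/-- The two integrations run along `I`, for `F'(φ(r))` and then `F(φ(r))` as functions of `r`, so
`φ` is never inverted. -/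
lemma coupling_form_of_deriv_deriv (hI : IsOpen I) (hc : I.OrdConnected)
    (hφ : ContDiffOn ℝ ∞ φ I) (hF : ∀ r ∈ I, ContDiffAt ℝ ∞ F (φ r))
    (h2 : ∀ r ∈ I, (n : ℝ) / 2 + ((n : ℝ) + 1) * deriv (deriv F) (φ r) = 0) :
    ∃ C₁ C₂ : ℝ, ∀ r ∈ I,
      F (φ r) = -((n : ℝ) / (4 * ((n : ℝ) + 1))) * φ r ^ 2 + C₁ * φ r + C₂ := by
  have hn : (n : ℝ) + 1 ≠ 0 := by positivity
  obtain ⟨C₁, hC₁⟩ := exists_eq_of_hasDerivAt_zero hI hc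
      (f := fun r => deriv F (φ r) + (n : ℝ) / (2 * ((n : ℝ) + 1)) * φ r) fun r hr => by
    have h1 : HasDerivAt (fun s => deriv F (φ s)) (deriv (deriv F) (φ r) * deriv φ r) r :=
      (hasDerivAt_deriv_of_contDiffAt (hF r hr)).comp r (hasDerivAt_of_smooth hφ hI hr)
    refine (h1.fun_add ((hasDerivAt_of_smooth hφ hI hr).const_mul
      ((n : ℝ) / (2 * ((n : ℝ) + 1))))).congr_deriv ?_
    field_simp
    linear_combination 2 * deriv φ r * h2 r hr
  obtain ⟨C₂, hC₂⟩ := exists_eq_of_hasDerivAt_zero hI hc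
      (f := fun r => F (φ r) + (n : ℝ) / (4 * ((n : ℝ) + 1)) * φ r ^ 2 - C₁ * φ r) fun r hr => by
    have hφr := hasDerivAt_of_smooth hφ hI hr
    have h1 : HasDerivAt (fun s => F (φ s)) (deriv F (φ r) * deriv φ r) r :=
      (((hF r hr).differentiableAt (by simp)).hasDerivAt).comp r hφr
    refine ((h1.fun_add ((hφr.fun_pow 2).const_mul ((n : ℝ) / (4 * ((n : ℝ) + 1))))).fun_sub
      (hφr.const_mul C₁)).congr_deriv ?_
    rw [← hC₁ r hr]
    field_simp
    push_cast
    ring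
  exact ⟨C₁, C₂, fun r hr => by linear_combination hC₂ r hr⟩

/-! ## The coupling function `1 - n φ² / (4 (n + 1))` -/

lemma deriv_coupling (n : ℕ) :
    deriv (coupling n) = fun x => -((n : ℝ) / (2 * ((n : ℝ) + 1))) * x := by
  funext x
  have : HasDerivAt (coupling n) (0 - (n : ℝ) / (4 * ((n : ℝ) + 1)) * (((2 : ℕ) : ℝ) * x ^ 1)) x :=
    (hasDerivAt_const x (1 : ℝ)).sub ((hasDerivAt_pow 2 x).const_mul _)
  rw [this.deriv]
  field_simp
  push_cast
  ring

lemma deriv_deriv_coupling (n : ℕ) (x : ℝ) :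
    deriv (deriv (coupling n)) x = -((n : ℝ) / (2 * ((n : ℝ) + 1))) := by
  rw [deriv_coupling]
  simp

lemma contDiff_coupling (n : ℕ) : ContDiff ℝ ∞ (coupling n) := by
  unfold coupling
  fun_prop

/-- In the trace identity the `φ²` terms of `(n/2) F` and `((n + 1)/2) F'²` cancel, leaving `(n/2)
R`, while the coefficient of `(∇φ)²` vanishes. -/
lemma RadialFieldEquations.scalar_and_box_eq_zero (hn : 1 ≤ n) (hb : IsStaticBackground I P Q)
    (hφ : ContDiffOn ℝ ∞ φ I) (hF0 : coupling n (φ r) ≠ 0) (hr : r ∈ I)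
    (hfe : RadialFieldEquations n χ (coupling n) P Q φ r) :
    scalarRadial n χ P Q r = 0 ∧ boxRadial n P Q φ r = 0 := by
  have hn0 : (n : ℝ) ≠ 0 := by positivity
  have htr := hfe.trace hb hφ (fun _ _ => (contDiff_coupling n).contDiffAt) hF0 hr
  have hR : scalarRadial n χ P Q r = 0 := by
    rw [deriv_deriv_coupling, deriv_coupling, coupling] at htr
    have hl : (n : ℝ) / 2 * (1 - (n : ℝ) / (4 * ((n : ℝ) + 1)) * φ r ^ 2) +
        ((n : ℝ) + 1) / 2 * (-((n : ℝ) / (2 * ((n : ℝ) + 1))) * φ r) ^ 2 = n / 2 := by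
      field_simp
      ring
    have hg : (n : ℝ) / 2 + ((n : ℝ) + 1) * -((n : ℝ) / (2 * ((n : ℝ) + 1))) = 0 := by
      field_simp
      ring
    rw [hl, hg, zero_mul] at htr
    simpa [hn0] using htr
  refine ⟨hR, ?_⟩
  rw [hfe.2.2.2, hR, mul_zero]

/-- `Rʳᵣ - Rᵗₜ = n (PQ)' / (2 r P Q²)`. -/
lemma mul_eq_const_of_ricci (hn : 1 ≤ n) (hb : IsStaticBackground I P Q) (hc : I.OrdConnected)
    (hne : I.Nonempty) (h : ∀ r ∈ I, ricciRadius n P Q r = ricciTime n P Q r) :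
    ∃ c : ℝ, 0 < c ∧ ∀ r ∈ I, P r * Q r = c := by
  have hn0 : (n : ℝ) ≠ 0 := by positivity
  obtain ⟨c, hc⟩ := exists_eq_of_hasDerivAt_zero hb.isOpen hc (f := fun r => P r * Q r)
    fun r hr => by
      have hr0 := hb.ne_zero hr
      have hP0 := hb.P_ne_zero hr
      have hQ0 := hb.Q_ne_zero hr
      refine ((hasDerivAt_of_smooth hb.smooth_P hb.isOpen hr).fun_mul
        (hasDerivAt_of_smooth hb.smooth_Q hb.isOpen hr)).congr_deriv ?_
      have := h r hr
      have h2 : (n : ℝ) * deriv Q r / (2 * r * Q r ^ 2) +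
        n * deriv P r / (2 * r * P r * Q r) = 0 := by
        simp only [ricciRadius, ricciTime] at this
        linear_combination this
      field_simp at h2
      exact mul_left_cancel₀ hn0 (by linear_combination h2)
  obtain ⟨r, hr⟩ := hne
  exact ⟨c, hc r hr ▸ hb.lorentzian r hr, hc⟩

end

/-! ## Static metrics with `P = c f`, `Q = 1 / f` -/

section
variable {I : Set ℝ} {f P Q φ : ℝ → ℝ} {c χ r : ℝ}

/-- `P = c f`, `Q = f⁻¹` on `I` for a smooth nowhere vanishing function `f` and `c > 0`. -/
structure IsReciprocal (I : Set ℝ) (c : ℝ) (f P Q : ℝ → ℝ) : Prop where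
  isOpen : IsOpen I
  pos : ∀ r ∈ I, 0 < r
  smooth : ContDiffOn ℝ ∞ f I
  ne_zero : ∀ r ∈ I, f r ≠ 0
  c_pos : 0 < c
  P_eq : ∀ r ∈ I, P r = c * f r
  Q_eq : ∀ r ∈ I, Q r = (f r)⁻¹

namespace IsReciprocal

lemma background (h : IsReciprocal I c f P Q) : IsStaticBackground I P Q where
  isOpen := h.isOpen
  pos := h.pos
  smooth_P := (contDiffOn_const.mul h.smooth).congr h.P_eq
  smooth_Q := (h.smooth.inv h.ne_zero).congr h.Q_eq
  lorentzian r hr := by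
    rw [h.P_eq r hr, h.Q_eq r hr, mul_assoc, mul_inv_cancel₀ (h.ne_zero r hr), mul_one]
    exact h.c_pos

lemma deriv_P (h : IsReciprocal I c f P Q) (hr : r ∈ I) : deriv P r = c * deriv f r := by
  have : P =ᶠ[𝓝 r] fun s => c * f s := by
    filter_upwards [h.isOpen.mem_nhds hr] with s hs using h.P_eq s hs
  rw [this.deriv_eq, deriv_const_mul_field]

lemma deriv_deriv_P (h : IsReciprocal I c f P Q) (hr : r ∈ I) :
    deriv (deriv P) r = c * deriv (deriv f) r := by
  have : deriv P =ᶠ[𝓝 r] fun s => c * deriv f s := by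
    filter_upwards [h.isOpen.mem_nhds hr] with s hs using h.deriv_P hs
  rw [this.deriv_eq, deriv_const_mul_field]

lemma deriv_Q (h : IsReciprocal I c f P Q) (hr : r ∈ I) :
    deriv Q r = -deriv f r / f r ^ 2 := by
  have : Q =ᶠ[𝓝 r] fun s => (f s)⁻¹ := by
    filter_upwards [h.isOpen.mem_nhds hr] with s hs using h.Q_eq s hs
  rw [this.deriv_eq]
  exact ((hasDerivAt_of_smooth h.smooth h.isOpen hr).fun_inv (h.ne_zero r hr)).deriv

lemma ricciTime_eq (h : IsReciprocal I c f P Q) (hr : r ∈ I) :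
    ricciTime n P Q r = -(deriv (deriv f) r / 2) - n * deriv f r / (2 * r) := by
  have hr0 := (h.pos r hr).ne'
  have hf0 := h.ne_zero r hr
  have hc0 := h.c_pos.ne'
  rw [ricciTime, h.deriv_deriv_P hr, h.deriv_P hr, h.deriv_Q hr, h.P_eq r hr, h.Q_eq r hr]
  field_simp
  ring

lemma ricciRadius_eq (h : IsReciprocal I c f P Q) (hr : r ∈ I) :
    ricciRadius n P Q r = -(deriv (deriv f) r / 2) - n * deriv f r / (2 * r) := by
  have hr0 := (h.pos r hr).ne'
  have hf0 := h.ne_zero r hr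
  have hc0 := h.c_pos.ne'
  rw [ricciRadius, h.deriv_deriv_P hr, h.deriv_P hr, h.deriv_Q hr, h.P_eq r hr, h.Q_eq r hr]
  field_simp
  ring

lemma ricciBase_eq (h : IsReciprocal I c f P Q) (hr : r ∈ I) :
    ricciBase n χ P Q r = (((n : ℝ) - 1) * (χ - f r) - r * deriv f r) / r ^ 2 := by
  have hr0 := (h.pos r hr).ne'
  have hf0 := h.ne_zero r hr
  have hc0 := h.c_pos.ne'
  rw [ricciBase, h.deriv_P hr, h.deriv_Q hr, h.P_eq r hr, h.Q_eq r hr]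
  field_simp
  ring

lemma hessTime_eq (h : IsReciprocal I c f P Q) (hr : r ∈ I) (u : ℝ → ℝ) :
    hessTime P Q u r = deriv f r * deriv u r / 2 := by
  have hf0 := h.ne_zero r hr
  have hc0 := h.c_pos.ne'
  rw [hessTime, h.deriv_P hr, h.P_eq r hr, h.Q_eq r hr]
  field_simp

lemma hessRadius_eq (h : IsReciprocal I c f P Q) (hr : r ∈ I) (u : ℝ → ℝ) :
    hessRadius Q u r = f r * deriv (deriv u) r + deriv f r * deriv u r / 2 := by
  have hf0 := h.ne_zero r hr
  rw [hessRadius, h.deriv_Q hr, h.Q_eq r hr]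
  field_simp
  ring

lemma hessBase_eq (h : IsReciprocal I c f P Q) (hr : r ∈ I) (u : ℝ → ℝ) :
    hessBase Q u r = f r * deriv u r / r := by
  have hf0 := h.ne_zero r hr
  rw [hessBase, h.Q_eq r hr]
  field_simp

lemma gradSqRadial_eq (h : IsReciprocal I c f P Q) (hr : r ∈ I) (u : ℝ → ℝ) :
    gradSqRadial Q u r = f r * deriv u r ^ 2 := by
  rw [gradSqRadial, h.Q_eq r hr, div_inv_eq_mul, mul_comm]

lemma boxRadial_eq (h : IsReciprocal I c f P Q) (hr : r ∈ I) (u : ℝ → ℝ) :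
    boxRadial n P Q u r =
      f r * deriv (deriv u) r + deriv f r * deriv u r + n * (f r * deriv u r / r) := by
  rw [boxRadial, h.hessTime_eq hr, h.hessRadius_eq hr, h.hessBase_eq hr]
  ring

end IsReciprocal

lemma IsStaticBackground.isReciprocal (hb : IsStaticBackground I P Q) (hc : 0 < c)
    (hPQ : ∀ r ∈ I, P r * Q r = c) : IsReciprocal I c (fun r => (Q r)⁻¹) P Q where
  isOpen := hb.isOpen
  pos := hb.pos
  smooth := hb.smooth_Q.inv fun _ hr => hb.Q_ne_zero hr
  ne_zero _ hr := inv_ne_zero (hb.Q_ne_zero hr)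
  c_pos := hc
  P_eq r hr := by rw [← hPQ r hr, mul_assoc, mul_inv_cancel₀ (hb.Q_ne_zero hr), mul_one]
  Q_eq r _ := (inv_inv _).symm

/-! ### The scalar field on a reciprocal metric: first integrals and power laws. -/

lemma deriv_coupling_comp (n : ℕ) (hI : IsOpen I) (hφ : ContDiffOn ℝ ∞ φ I) (hr : r ∈ I) :
    deriv (fun s => coupling n (φ s)) r = -((n : ℝ) / (2 * ((n : ℝ) + 1))) * φ r * deriv φ r := by
  rw [deriv_comp_eq hI hφ (fun _ _ => (contDiff_coupling n).contDiffAt) hr, deriv_coupling]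

lemma deriv_deriv_coupling_comp (n : ℕ) (hI : IsOpen I) (hφ : ContDiffOn ℝ ∞ φ I) (hr : r ∈ I) :
    deriv (deriv (fun s => coupling n (φ s))) r =
      -((n : ℝ) / (2 * ((n : ℝ) + 1))) * (deriv φ r ^ 2 + φ r * deriv (deriv φ) r) := by
  rw [deriv_deriv_comp_eq hI hφ (fun _ _ => (contDiff_coupling n).contDiffAt) hr,
    deriv_deriv_coupling, deriv_coupling]
  ring

lemma boxRadial_coupling (n : ℕ) (h : IsReciprocal I c f P Q) (hφ : ContDiffOn ℝ ∞ φ I)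
    (hr : r ∈ I) (hbox : boxRadial n P Q φ r = 0) :
    boxRadial n P Q (fun s => coupling n (φ s)) r =
      -((n : ℝ) / (2 * ((n : ℝ) + 1))) * (f r * deriv φ r ^ 2) := by
  rw [boxRadial_comp n h.background hφ (fun _ _ => (contDiff_coupling n).contDiffAt) hr, hbox,
    deriv_deriv_coupling, h.gradSqRadial_eq hr]
  ring

/-- The first integrals of the scalar field equations. -/
lemma exists_first_integrals (hn : 1 ≤ n) (h : IsReciprocal I c f P Q) (hc : I.OrdConnected)
    (hφ : ContDiffOn ℝ ∞ φ I) (hF0 : ∀ r ∈ I, coupling n (φ r) ≠ 0)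
    (hbox : ∀ r ∈ I, boxRadial n P Q φ r = 0)
    (hrt : ∀ r ∈ I, stressRadius n (coupling n) P Q φ r = stressTime n (coupling n) P Q φ r)
    (hne : ¬ ∃ φ₀ : ℝ, ∀ r ∈ I, φ r = φ₀) :
    ∃ M κ : ℝ, κ ≠ 0 ∧ ∀ r ∈ I, r ≠ M ∧ φ r ≠ 0 ∧ deriv φ r ≠ 0 ∧
      r ^ n * f r * deriv φ r = κ ∧ n * φ r = -2 * (r - M) * deriv φ r := by
  have hn0 : (n : ℝ) ≠ 0 := by positivity
  have hn1 : (n : ℝ) + 1 ≠ 0 := by positivity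
  have hn2 : (n : ℝ) + 2 ≠ 0 := by positivity
  -- The box is in divergence form: `rⁿ ∇²φ = (rⁿ f φ')'`.
  obtain ⟨κ, hκ⟩ := exists_eq_of_hasDerivAt_zero h.isOpen hc
    (f := fun r => r ^ n * f r * deriv φ r) fun r hr => by
      have hr0 := (h.pos r hr).ne'
      have hb := hbox r hr
      rw [h.boxRadial_eq hr] at hb
      refine (((hasDerivAt_pow n r).fun_mul (hasDerivAt_of_smooth h.smooth h.isOpen hr)).fun_mul
        (hasDerivAt_deriv_of_smooth hφ h.isOpen hr)).congr_deriv ?_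
      -- The truncated subtraction is harmless because `1 ≤ n`.
      have hpow : (n : ℝ) * r ^ (n - 1) = n * r ^ n / r := by
        obtain ⟨m, rfl⟩ := Nat.exists_eq_add_of_le' hn
        rw [Nat.add_sub_cancel, pow_succ]
        field_simp
      rw [hpow]
      linear_combination r ^ n * hb
  -- In `Tʳᵣ - Tᵗₜ` the box terms and the terms in `f'` cancel, leaving `f (F(φ)'' + φ'²) = 0`.
  have hode : ∀ r ∈ I, n * (φ r * deriv (deriv φ) r) = (n + 2) * deriv φ r ^ 2 := by
    intro r hr
    have hf0 := h.ne_zero r hr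
    have h1 := mul_left_cancel₀ (inv_ne_zero (hF0 r hr)) (hrt r hr)
    rw [h.hessTime_eq hr, h.hessRadius_eq hr, deriv_deriv_coupling_comp n h.isOpen hφ hr,
      h.gradSqRadial_eq hr] at h1
    have h2 : f r * (-((n : ℝ) / (2 * ((n : ℝ) + 1))) *
        (deriv φ r ^ 2 + φ r * deriv (deriv φ) r) + deriv φ r ^ 2) = 0 := by
      linear_combination h1
    have h3 := (mul_eq_zero.1 h2).resolve_left hf0
    field_simp at h3
    linear_combination -h3
  have hκ0 : κ ≠ 0 := by
    rintro rfl
    apply hne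
    refine exists_eq_of_hasDerivAt_zero h.isOpen hc fun r hr => ?_
    have h1 := hκ r hr
    have h2 : deriv φ r = 0 := by
      simpa [(h.pos r hr).ne', h.ne_zero r hr] using h1
    exact h2 ▸ hasDerivAt_of_smooth hφ h.isOpen hr
  have hφ' : ∀ r ∈ I, deriv φ r ≠ 0 := by
    intro r hr h0
    exact hκ0 (by rw [← hκ r hr, h0, mul_zero])
  have hφ0 : ∀ r ∈ I, φ r ≠ 0 := by
    intro r hr h0
    have := hode r hr
    rw [h0, zero_mul, mul_zero] at this
    exact mul_ne_zero hn2 (pow_ne_zero 2 (hφ' r hr)) this.symm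
  -- The equation `hode` says `(φ/φ')' = -2/n`; the constant of integration is `m = 2M`.
  obtain ⟨m, hm⟩ := exists_eq_of_hasDerivAt_zero h.isOpen hc
    (f := fun r => n * (φ r / deriv φ r) + 2 * r) fun r hr => by
      have h0 := hφ' r hr
      refine (((((hasDerivAt_of_smooth hφ h.isOpen hr).fun_div
        (hasDerivAt_deriv_of_smooth hφ h.isOpen hr) h0)).const_mul (n : ℝ)).fun_add
        ((hasDerivAt_id' r).const_mul 2)).congr_deriv ?_
      field_simp
      linear_combination -hode r hr
  have hlin : ∀ r ∈ I, n * φ r = -2 * (r - m / 2) * deriv φ r := by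
    intro r hr
    have h0 := hφ' r hr
    have := hm r hr
    field_simp at this
    linear_combination this
  refine ⟨m / 2, κ, hκ0, fun r hr => ⟨?_, hφ0 r hr, hφ' r hr, hκ r hr, hlin r hr⟩⟩
  intro hrM
  have := hlin r hr
  rw [← hrM, sub_self] at this
  exact mul_ne_zero hn0 (hφ0 r hr) (by linear_combination this)

/-- With `∇²φ = 0` the box of `F(φ)` is a multiple of `f φ'²`, and the linear first integral turns
`φ φ'` into a multiple of `φ'²`, so `f φ'²` factors out. -/
lemma stressBase_of_first_integrals {M : ℝ} (hn : 1 ≤ n) (h : IsReciprocal I c f P Q)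
    (hφ : ContDiffOn ℝ ∞ φ I) (hr : r ∈ I) (hbox : boxRadial n P Q φ r = 0)
    (hM : n * φ r = -2 * (r - M) * deriv φ r) :
    stressBase n (coupling n) P Q φ r =
      (coupling n (φ r))⁻¹ * (f r * deriv φ r ^ 2 * (r - 2 * M) / (2 * (n + 1) * r)) := by
  have hr0 := (h.pos r hr).ne'
  have hn1 : (n : ℝ) + 1 ≠ 0 := by positivity
  rw [stressBase, boxRadial_coupling n h hφ hr hbox, h.gradSqRadial_eq hr, h.hessBase_eq hr,
    deriv_coupling_comp n h.isOpen hφ hr]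
  congr 1
  field_simp
  linear_combination (-1) * f r * deriv φ r * hM

/-- For this coupling `∇²φ = 0` makes the stress tensor traceless. Together with `Tʳᵣ = Tᵗₜ` this
expresses `Tʳᵣ` as `-n/2` times the base eigenvalue, so `φ''` need not be computed. -/
lemma stressRadius_of_first_integrals {M : ℝ} (hn : 1 ≤ n) (h : IsReciprocal I c f P Q)
    (hφ : ContDiffOn ℝ ∞ φ I) (hr : r ∈ I) (hbox : boxRadial n P Q φ r = 0)
    (hrt : stressRadius n (coupling n) P Q φ r = stressTime n (coupling n) P Q φ r)
    (hM : n * φ r = -2 * (r - M) * deriv φ r) :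
    stressRadius n (coupling n) P Q φ r =
      (coupling n (φ r))⁻¹ * (n * (f r * deriv φ r ^ 2) * (2 * M - r) / (4 * (n + 1) * r)) := by
  have hr0 := (h.pos r hr).ne'
  have hn1 : (n : ℝ) + 1 ≠ 0 := by positivity
  have htr : stressTime n (coupling n) P Q φ r + stressRadius n (coupling n) P Q φ r +
      n * stressBase n (coupling n) P Q φ r = 0 := by
    have hB := boxRadial_coupling n h hφ hr hbox
    have hB' : boxRadial n P Q (fun s => coupling n (φ s)) r =
      hessTime P Q (fun s => coupling n (φ s)) r +
      hessRadius Q (fun s => coupling n (φ s)) r +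
      n * hessBase Q (fun s => coupling n (φ s)) r := rfl
    rw [stressTime, stressRadius, stressBase, h.gradSqRadial_eq hr]
    have hg : ((n : ℝ) + 1) * boxRadial n P Q (fun s => coupling n (φ s)) r =
        -(n / 2) * (f r * deriv φ r ^ 2) := by
      rw [hB]
      field_simp
    linear_combination (coupling n (φ r))⁻¹ * (-hB' - hg)
  rw [← hrt, stressBase_of_first_integrals hn h hφ hr hbox hM] at htr
  have h2 : stressRadius n (coupling n) P Q φ r = -(n / 2) * ((coupling n (φ r))⁻¹ *
      (f r * deriv φ r ^ 2 * (r - 2 * M) / (2 * (n + 1) * r))) := by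
    linear_combination htr / 2
  rw [h2]
  field_simp
  ring

/-- On an interval that avoids `M`, the sign of `r - M` is constant. -/
lemma exists_sign {M : ℝ} (hc : I.OrdConnected) (hM : ∀ r ∈ I, r ≠ M) :
    ∃ ε : ℝ, ε * ε = 1 ∧ ∀ r ∈ I, |r - M| = ε * (r - M) := by
  by_cases hex : ∃ s ∈ I, M < s
  · obtain ⟨s, hs, hMs⟩ := hex
    refine ⟨1, by norm_num, fun r hr => ?_⟩
    have : M < r := by
      by_contra! hrM
      exact hM M (hc.out hr hs ⟨hrM, hMs.le⟩) rfl
    rw [one_mul, abs_of_pos (sub_pos.2 this)]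
  · push Not at hex
    refine ⟨-1, by norm_num, fun r hr => ?_⟩
    rw [abs_of_nonpos (sub_nonpos.2 (hex r hr)), neg_one_mul]

/-- The linear first integral is `φ'/φ = -(n/2) / (r - M)`, so `φ |r - M|^(n/2)` is constant, and
`f` is read off from `rⁿ f φ' = κ`. Writing `|r - M| = ε (r - M)` makes the base of the real power
differentiable. -/
lemma exists_power_law {M κ : ℝ} (hn : 1 ≤ n) (h : IsReciprocal I c f P Q) (hc : I.OrdConnected)
    (hI : I.Nonempty) (hφ : ContDiffOn ℝ ∞ φ I)
    (hfi : ∀ r ∈ I, r ≠ M ∧ φ r ≠ 0 ∧ deriv φ r ≠ 0 ∧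
      r ^ n * f r * deriv φ r = κ ∧ n * φ r = -2 * (r - M) * deriv φ r) :
    ∃ ε K : ℝ, ε * ε = 1 ∧ K ≠ 0 ∧ ∀ r ∈ I, |r - M| = ε * (r - M) ∧
      φ r = K * |r - M| ^ (-((n : ℝ) / 2)) ∧
      f r = (-2 * ε * κ / (n * K)) * |r - M| ^ (1 + (n : ℝ) / 2) / r ^ n := by
  have hn0 : (n : ℝ) ≠ 0 := by positivity
  obtain ⟨ε, hε, habs⟩ := exists_sign hc fun r hr => (hfi r hr).1
  have hε0 : ε ≠ 0 := left_ne_zero_of_mul (hε ▸ one_ne_zero)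
  have hpos : ∀ r ∈ I, 0 < |r - M| := fun r hr => abs_pos.2 (sub_ne_zero.2 (hfi r hr).1)
  obtain ⟨K, hK⟩ := exists_eq_of_hasDerivAt_zero h.isOpen hc
    (f := fun r => φ r * (ε * (r - M)) ^ ((n : ℝ) / 2)) fun r hr => by
      have hp : 0 < ε * (r - M) := habs r hr ▸ hpos r hr
      refine ((hasDerivAt_of_smooth hφ h.isOpen hr).fun_mul
        ((((hasDerivAt_id' r).sub_const M).const_mul ε).rpow_const
          (p := (n : ℝ) / 2) (Or.inl hp.ne'))).congr_deriv ?_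
      have h1 : (ε * (r - M)) ^ ((n : ℝ) / 2) =
          (ε * (r - M)) ^ ((n : ℝ) / 2 - 1) * (ε * (r - M)) := by
        rw [← Real.rpow_add_one hp.ne', sub_add_cancel]
      rw [h1]
      linear_combination (ε * (r - M)) ^ ((n : ℝ) / 2 - 1) * ε / 2 * (hfi r hr).2.2.2.2
  have hφK : ∀ r ∈ I, φ r = K * |r - M| ^ (-((n : ℝ) / 2)) := by
    intro r hr
    have := hK r hr
    rw [← this, ← habs r hr, mul_assoc, ← Real.rpow_add (hpos r hr), add_neg_cancel,
      Real.rpow_zero, mul_one]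
  have hK0 : K ≠ 0 := by
    rintro rfl
    obtain ⟨r, hr⟩ := hI
    exact (hfi r hr).2.1 (by rw [hφK r hr, zero_mul])
  refine ⟨ε, K, hε, hK0, fun r hr => ⟨habs r hr, hφK r hr, ?_⟩⟩
  obtain ⟨hrM, h0, h0', h1, h2⟩ := hfi r hr
  have hr0 := (h.pos r hr).ne'
  have hsub := sub_ne_zero.2 hrM
  have hρ : |r - M| ^ (1 + (n : ℝ) / 2) = |r - M| * (K / φ r) := by
    rw [Real.rpow_add (hpos r hr), Real.rpow_one, hφK r hr, Real.rpow_neg (hpos r hr).le]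
    have := (Real.rpow_pos_of_pos (hpos r hr) ((n : ℝ) / 2)).ne'
    field_simp
  rw [hρ, habs r hr]
  field_simp
  refine mul_right_cancel₀ h0' ?_
  linear_combination (n * φ r) * h1 + κ * h2 + 2 * κ * (r - M) * deriv φ r * hε
end

/-! ### Polynomial identities: the dimension and the extremal form. -/

section
variable {I : Set ℝ} {f P Q φ : ℝ → ℝ} {c χ r : ℝ}

lemma infinite_of_isOpen_of_nonempty (hI : IsOpen I) (hne : I.Nonempty) : I.Infinite := by
  obtain ⟨r, hr⟩ := hne
  exact infinite_of_mem_nhds r (hI.mem_nhds hr)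

lemma abs_rpow_neg_half (n : ℕ) {x : ℝ} (hx : 0 < |x|) :
    |x| ^ (-((n : ℝ) / 2)) = (√|x| ^ n)⁻¹ := by
  rw [Real.rpow_neg hx.le, Real.sqrt_eq_rpow, ← Real.rpow_natCast, ← Real.rpow_mul hx.le]
  congr 2
  ring

lemma abs_rpow_one_add_half_sq (n : ℕ) (x : ℝ) :
    (|x| ^ (1 + (n : ℝ) / 2)) ^ 2 = |x| ^ (n + 2) := by
  rw [← Real.rpow_natCast, ← Real.rpow_natCast, ← Real.rpow_mul (abs_nonneg x)]
  congr 1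
  push_cast
  ring

lemma stressRadius_power_law {M κ ε K C : ℝ} (hn : 1 ≤ n) (h : IsReciprocal I c f P Q)
    (hI : I.Nonempty) (hφ : ContDiffOn ℝ ∞ φ I)
    (hF0 : ∀ r ∈ I, coupling n (φ r) ≠ 0) (hbox : ∀ r ∈ I, boxRadial n P Q φ r = 0)
    (hrt : ∀ r ∈ I, stressRadius n (coupling n) P Q φ r = stressTime n (coupling n) P Q φ r)
    (hκ : κ ≠ 0)
    (hfi : ∀ r ∈ I, r ≠ M ∧ φ r ≠ 0 ∧ deriv φ r ≠ 0 ∧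
      r ^ n * f r * deriv φ r = κ ∧ n * φ r = -2 * (r - M) * deriv φ r)
    (hε : ε * ε = 1) (hK : K ≠ 0)
    (hpl : ∀ r ∈ I, |r - M| = ε * (r - M) ∧ φ r = K * |r - M| ^ (-((n : ℝ) / 2)))
    (hC : ∀ r ∈ I, stressRadius n (coupling n) P Q φ r = C / r ^ (n + 2)) :
    n = 2 ∧ 4 * κ * K = 24 * C * ε ∧ 6 * M ^ 2 = K ^ 2 := by
  have hn0 : (n : ℝ) ≠ 0 := by positivity
  have hn1 : (n : ℝ) + 1 ≠ 0 := by positivity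
  -- The condition `Tʳᵣ = C / r^(n+2)`, cleared of denominators and multiplied by `z^(2n)`, where `z
  -- = √|r - M|`, `r = M + ε z²` and `φ zⁿ = K`. The square root keeps the exponents integral for
  -- odd `n`.
  let p : Polynomial ℝ := Polynomial.C (n ^ 2 * κ * K * M ^ 2) * Polynomial.X ^ n
    - Polynomial.C (n ^ 2 * κ * K) * Polynomial.X ^ (n + 4)
    + Polynomial.C (8 * (n + 1) * C * ε) * Polynomial.X ^ (2 * n + 2)
    - Polynomial.C (2 * n * C * ε * K ^ 2) * Polynomial.X ^ 2
  have hz : ∀ r ∈ I, r = M + ε * √|r - M| ^ 2 := by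
    intro r hr
    rw [Real.sq_sqrt (abs_nonneg _), (hpl r hr).1]
    linear_combination (M - r) * hε
  have hroot : ∀ r ∈ I, p.IsRoot (√|r - M|) := by
    intro r hr
    obtain ⟨hrM, h0, h0', h1, h2⟩ := hfi r hr
    have hr0 := (h.pos r hr).ne'
    have hpos : 0 < |r - M| := abs_pos.2 (sub_ne_zero.2 hrM)
    have hzpos : 0 < √|r - M| := Real.sqrt_pos.2 hpos
    have hst := stressRadius_of_first_integrals hn h hφ hr (hbox r hr) (hrt r hr) h2
    rw [hC r hr, eq_inv_mul_iff_mul_eq₀ (hF0 r hr)] at hst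
    have hst2 : 4 * (n + 1) * C * coupling n (φ r) = n * κ * deriv φ r * (2 * M - r) * r := by
      rw [← h1]
      rw [pow_add] at hst
      field_simp at hst
      linear_combination hst
    have hst3 : n ^ 2 * κ * φ r * (r * (2 * M - r)) + 8 * (n + 1) * C * (r - M)
        - 2 * n * C * (r - M) * φ r ^ 2 = 0 := by
      rw [coupling] at hst2
      field_simp at hst2
      linear_combination 2 * (r - M) * hst2 + n * κ * (2 * M - r) * r * h2
    have hφz : φ r * √|r - M| ^ n = K := by
      rw [(hpl r hr).2, abs_rpow_neg_half n hpos, mul_assoc, inv_mul_cancel₀ (by positivity),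
        mul_one]
    have hrz := hz r hr
    set z := √|r - M|
    simp only [p, Polynomial.IsRoot, Polynomial.eval_add, Polynomial.eval_sub,
      Polynomial.eval_mul, Polynomial.eval_C, Polynomial.eval_pow, Polynomial.eval_X]
    have e1 : r - M = ε * z ^ 2 := by linear_combination hrz
    have e2 : r * (2 * M - r) = M ^ 2 - z ^ 4 := by
      linear_combination (-(r - M) - ε * z ^ 2) * e1 - z ^ 4 * hε
    rw [e1, e2] at hst3
    rw [← hφz]
    linear_combination z ^ (2 * n) * hst3
  have hp : p = 0 := by
    apply Polynomial.eq_zero_of_infinite_isRoot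
    -- `z` determines `r = M + ε z²`, so infinitely many radii give infinitely many roots.
    refine ((infinite_of_isOpen_of_nonempty h.isOpen hI).image
      (f := fun r => √|r - M|) fun r hr s hs hrs => ?_).mono ?_
    · rw [hz r hr, hz s hs]
      simp only at hrs
      rw [hrs]
    · rintro _ ⟨r, hr, rfl⟩
      exact hroot r hr
  have hc1 := congrArg (fun q => Polynomial.coeff q (n + 4)) hp
  -- The term `-n² κ K X^(n+4)` does not vanish, and only `X^(2n+2)` can cancel it.
  have hn2 : n = 2 := by
    by_contra hne
    have e1 : n + 4 ≠ 2 * n + 2 := by omega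
    have e2 : n + 4 ≠ 2 := by omega
    simp only [p, Polynomial.coeff_sub, Polynomial.coeff_add, Polynomial.coeff_C_mul,
    Polynomial.coeff_X_pow, Polynomial.coeff_zero] at hc1
    simp [e1, e2, hn0, hκ, hK] at hc1
  subst hn2
  have hc2 := congrArg (fun q => Polynomial.coeff q 2) hp
  simp only [p, Polynomial.coeff_sub, Polynomial.coeff_add, Polynomial.coeff_C_mul,
    Polynomial.coeff_X_pow, Polynomial.coeff_zero] at hc1 hc2
  norm_num at hc1 hc2
  have h6 : 4 * κ * K = 24 * C * ε := by linear_combination -hc1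
  refine ⟨rfl, h6, ?_⟩
  have : 4 * κ * K * (6 * M ^ 2) = 4 * κ * K * K ^ 2 := by
    linear_combination 6 * hc2 - K ^ 2 * h6
  exact mul_left_cancel₀ (by positivity) this

/-- In space-time dimension four the power law takes the extremal Reissner–Nordström form. -/
lemma exists_extremal_form {M κ ε K C : ℝ} (h : IsReciprocal I c f P Q)
    (hκ : κ ≠ 0) (hε : ε * ε = 1) (hK : K ≠ 0)
    (hfi : ∀ r ∈ I, r ≠ M)
    (hpl : ∀ r ∈ I, |r - M| = ε * (r - M) ∧ φ r = K * |r - M| ^ (-(((2 : ℕ) : ℝ) / 2)) ∧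
      f r = (-2 * ε * κ / (((2 : ℕ) : ℝ) * K)) * |r - M| ^ (1 + ((2 : ℕ) : ℝ) / 2) / r ^ 2)
    (h1 : 4 * κ * K = 24 * C * ε) (h2 : 6 * M ^ 2 = K ^ 2) :
    ∃ b s : ℝ, M ≠ 0 ∧ b ≠ 0 ∧ (s = 1 ∨ s = -1) ∧ C = -b * M ^ 2 ∧
      ∀ r ∈ I, r ≠ M ∧ φ r = s * (√6 * M / (r - M)) ∧ f r = b * (1 - M / r) ^ 2 := by
  have hε0 : ε ≠ 0 := left_ne_zero_of_mul (hε ▸ one_ne_zero)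
  have hM0 : M ≠ 0 := by
    rintro rfl
    exact hK (by simpa using h2.symm)
  -- `φ = K / |r - M| = ε K / (r - M)`, and `K² = 6 M²` fixes `ε K` up to sign.
  have hs : ∃ s : ℝ, (s = 1 ∨ s = -1) ∧ ε * K = s * (√6 * M) := by
    have hsq : (ε * K) ^ 2 = (√6 * M) ^ 2 := by
      rw [mul_pow √6, Real.sq_sqrt (by norm_num)]
      linear_combination K ^ 2 * hε - h2
    rcases sq_eq_sq_iff_eq_or_eq_neg.1 hsq with h | h
    · exact ⟨1, Or.inl rfl, by rw [h, one_mul]⟩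
    · exact ⟨-1, Or.inr rfl, by rw [h, neg_one_mul]⟩
  obtain ⟨s, hs, hsK⟩ := hs
  -- The first witness is the coefficient `-2 ε κ / (n K)` of the power law at `n = 2`.
  refine ⟨-ε * κ / K, s, hM0,
    div_ne_zero (mul_ne_zero (neg_ne_zero.2 hε0) hκ) hK, hs, ?_, fun r hr => ⟨hfi r hr, ?_, ?_⟩⟩
  · field_simp
    linear_combination (-(ε * K / 24)) * h1 - ε * κ / 6 * h2 - C * K * hε
  · obtain ⟨ha, hφ, -⟩ := hpl r hr
    have h0 := sub_ne_zero.2 (hfi r hr)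
    have hpos : 0 < |r - M| := abs_pos.2 h0
    have : -(((2 : ℕ) : ℝ) / 2) = -1 := by norm_num
    rw [hφ, this, Real.rpow_neg_one, ha, ← mul_div_assoc, ← hsK]
    field_simp
    linear_combination -hε
  · obtain ⟨ha, -, hf⟩ := hpl r hr
    have h0 := sub_ne_zero.2 (hfi r hr)
    have hr0 := (h.pos r hr).ne'
    have : 1 + (((2 : ℕ) : ℝ) / 2) = ((2 : ℕ) : ℝ) := by norm_num
    rw [hf, this, Real.rpow_natCast, sq_abs]
    field_simp
    push_cast
    ring

/-- For `P = c f`, `Q = 1/f` one has `rⁿ R = -(rⁿ (f - χ))''`; the constant `A` is the first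
derivative of `rⁿ (f - χ)`. -/
lemma exists_integrals_of_scalarRadial_eq_zero (hn : 1 ≤ n) (h : IsReciprocal I c f P Q)
    (hc : I.OrdConnected) (hR : ∀ r ∈ I, scalarRadial n χ P Q r = 0) :
    ∃ A D : ℝ, ∀ r ∈ I, r ^ n * (n * (f r - χ) / r + deriv f r) = A ∧
      r ^ n * (f r - χ) = A * r + D := by
  have hpow : ∀ r ∈ I, (n : ℝ) * r ^ (n - 1) = n * r ^ n / r := by
    intro r hr
    have hr0 := (h.pos r hr).ne'
    obtain ⟨m, rfl⟩ := Nat.exists_eq_add_of_le' hn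
    rw [Nat.add_sub_cancel, pow_succ]
    field_simp
  obtain ⟨A, hA⟩ := exists_eq_of_hasDerivAt_zero h.isOpen hc
    (f := fun r => r ^ n * (n * (f r - χ) / r + deriv f r)) fun r hr => by
      have hr0 := (h.pos r hr).ne'
      have hRr := hR r hr
      rw [scalarRadial, h.ricciTime_eq hr, h.ricciRadius_eq hr, h.ricciBase_eq hr] at hRr
      refine ((hasDerivAt_pow n r).fun_mul
        (((((hasDerivAt_of_smooth h.smooth h.isOpen hr).sub_const χ).const_mul (n : ℝ)).fun_div
          (hasDerivAt_id' r) hr0).fun_add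
          (hasDerivAt_deriv_of_smooth h.smooth h.isOpen hr))).congr_deriv ?_
      rw [hpow r hr]
      field_simp at hRr ⊢
      linear_combination -(r ^ n / 2) * hRr
  obtain ⟨D, hD⟩ := exists_eq_of_hasDerivAt_zero h.isOpen hc
    (f := fun r => r ^ n * (f r - χ) - A * r) fun r hr => by
      have hr0 := (h.pos r hr).ne'
      refine (((hasDerivAt_pow n r).fun_mul
        ((hasDerivAt_of_smooth h.smooth h.isOpen hr).sub_const χ)).fun_sub
        ((hasDerivAt_id' r).const_mul A)).congr_deriv ?_
      rw [hpow r hr, ← hA r hr]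
      field_simp
      ring
  exact ⟨A, D, fun r hr => ⟨hA r hr, by linear_combination hD r hr⟩⟩

/-- Squaring removes the half-integral power, leaving `n + 2 = 2 deg q` with `q = χ Xⁿ + A X + D`.
If `χ = 0` or `n = 1` then `deg q ≤ 1`, which contradicts `n ≥ 1`; otherwise `deg q = n`, hence `n =
2`. -/
lemma dimension_eq_two {A D M b ε : ℝ} (hn : 1 ≤ n) (hI : I.Infinite) (hε : ε * ε = 1)
    (hb : b ≠ 0)
    (hI' : ∀ r ∈ I, |r - M| = ε * (r - M) ∧
      b * |r - M| ^ (1 + (n : ℝ) / 2) = χ * r ^ n + A * r + D) :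
    n = 2 ∧ χ ≠ 0 := by
  have hε0 : ε ≠ 0 := left_ne_zero_of_mul (hε ▸ one_ne_zero)
  let p : Polynomial ℝ :=
    Polynomial.C (b ^ 2 * ε ^ (n + 2)) * (Polynomial.X - Polynomial.C M) ^ (n + 2)
  let q : Polynomial ℝ := Polynomial.C χ * Polynomial.X ^ n +
    (Polynomial.C A * Polynomial.X + Polynomial.C D)
  have hpq : p = q ^ 2 := by
    apply Polynomial.eq_of_infinite_eval_eq
    refine hI.mono fun r hr => ?_
    obtain ⟨h1, h2⟩ := hI' r hr
    simp only [p, q, Set.mem_ofPred_eq, Polynomial.eval_add, Polynomial.eval_sub,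
      Polynomial.eval_mul, Polynomial.eval_C, Polynomial.eval_pow, Polynomial.eval_X]
    rw [← add_assoc, ← h2, mul_pow, abs_rpow_one_add_half_sq, h1, mul_pow, mul_assoc]
  have hdeg : n + 2 = 2 * q.natDegree := by
    have := congrArg Polynomial.natDegree hpq
    rwa [Polynomial.natDegree_pow, Polynomial.natDegree_C_mul (by positivity),
      Polynomial.natDegree_pow, Polynomial.natDegree_X_sub_C, mul_one] at this
  have hlin : (Polynomial.C A * Polynomial.X + Polynomial.C D).natDegree ≤ 1 :=
    Polynomial.natDegree_linear_le
  have hχ : χ ≠ 0 := by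
    rintro rfl
    have : q.natDegree ≤ 1 := by simpa [q] using hlin
    omega
  refine ⟨?_, hχ⟩
  have hmon : (Polynomial.C χ * Polynomial.X ^ n).natDegree = n :=
    Polynomial.natDegree_C_mul_X_pow n χ hχ
  rcases Nat.lt_or_ge 1 n with h1 | h1
  · have : q.natDegree = n := by
      rw [Polynomial.natDegree_add_eq_left_of_natDegree_lt (by omega), hmon]
    omega
  · have : q.natDegree ≤ 1 :=
      (Polynomial.natDegree_add_le _ _).trans (max_le (by omega) hlin)
    omega

/-- Here `f = χ + A/r + D/r²` and `Rʳᵣ = -(f'' + 2 f'/r)/2`, which kills the constant and `1/r` and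
sends `D/r²` to `-D/r⁴`. -/
lemma ricciRadius_of_integrals {A D : ℝ} (h : IsReciprocal I c f P Q) (hr : r ∈ I)
    (hR : scalarRadial 2 χ P Q r = 0)
    (h1 : r ^ 2 * ((2 : ℕ) * (f r - χ) / r + deriv f r) = A)
    (h2 : r ^ 2 * (f r - χ) = A * r + D) : ricciRadius 2 P Q r = -D / r ^ 4 := by
  have hr0 := (h.pos r hr).ne'
  rw [scalarRadial, h.ricciTime_eq hr, h.ricciRadius_eq hr, h.ricciBase_eq hr] at hR
  rw [h.ricciRadius_eq hr]
  push_cast at hR h1 ⊢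
  have hD : D = -r ^ 2 * (f r - χ) - r ^ 3 * deriv f r := by
    field_simp at h1
    linear_combination r * h1 - h2
  have hf2 : deriv (deriv f) r = -4 * deriv f r / r - 2 * (f r - χ) / r ^ 2 := by
    field_simp at hR ⊢
    linear_combination -hR / 2
  rw [hD, hf2]
  field_simp
  ring
end

/-! ## The extremal solutions -/

/-- The set of radii on which the extremal solution with parameter `M` is defined is open. -/
lemma isOpen_extremal_radii (M : ℝ) : IsOpen {r : ℝ | 0 < r ∧ r ≠ M ∧ r ≠ 2 * M} :=
  isOpen_Ioi.inter (isOpen_ne.inter isOpen_ne)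

section
variable {M χ s r : ℝ} {f φ : ℝ → ℝ}

lemma hasDerivAt_extremal (hf : ∀ r, f r = χ * (1 - M / r) ^ 2) (hr : r ≠ 0) :
    HasDerivAt f (2 * χ * (1 - M / r) * (M / r ^ 2)) r := by
  rw [funext hf]
  refine (((((hasDerivAt_const r M).fun_div (hasDerivAt_id' r) hr).const_sub 1).fun_pow
    2).const_mul χ).congr_deriv ?_
  push_cast
  ring

lemma deriv_deriv_extremal (hf : ∀ r, f r = χ * (1 - M / r) ^ 2) (hr : r ≠ 0) :
    deriv (deriv f) r = χ * (6 * M ^ 2 / r ^ 4 - 4 * M / r ^ 3) := by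
  have : deriv f =ᶠ[𝓝 r] fun r => 2 * χ * (1 - M / r) * (M / r ^ 2) := by
    filter_upwards [isOpen_ne.mem_nhds hr] with r hr using (hasDerivAt_extremal hf hr).deriv
  rw [this.deriv_eq]
  refine HasDerivAt.deriv (((((hasDerivAt_const r M).fun_div (hasDerivAt_id' r) hr).const_sub
    1).const_mul (2 * χ)).fun_mul ((hasDerivAt_const r M).fun_div (hasDerivAt_pow 2 r)
    (pow_ne_zero 2 hr)) |>.congr_deriv ?_)
  field_simp
  push_cast
  ring

lemma hasDerivAt_extremal_scalar (hφ : ∀ r, φ r = s * (√6 * M / (r - M))) (hr : r ≠ M) :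
    HasDerivAt φ (-(s * (√6 * M)) / (r - M) ^ 2) r := by
  rw [funext hφ]
  refine (((hasDerivAt_const r (√6 * M)).fun_div ((hasDerivAt_id' r).sub_const M)
    (sub_ne_zero.2 hr)).const_mul s).congr_deriv ?_
  ring

lemma deriv_deriv_extremal_scalar (hφ : ∀ r, φ r = s * (√6 * M / (r - M))) (hr : r ≠ M) :
    deriv (deriv φ) r = 2 * (s * (√6 * M)) / (r - M) ^ 3 := by
  have hr0 := sub_ne_zero.2 hr
  have : deriv φ =ᶠ[𝓝 r] fun r => -(s * (√6 * M)) / (r - M) ^ 2 := by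
    filter_upwards [isOpen_ne.mem_nhds hr] with r hr using
      (hasDerivAt_extremal_scalar hφ hr).deriv
  rw [this.deriv_eq]
  refine HasDerivAt.deriv (((hasDerivAt_const r (-(s * (√6 * M)))).fun_div
    (((hasDerivAt_id' r).sub_const M).fun_pow 2) (pow_ne_zero 2 hr0)).congr_deriv ?_)
  field_simp
  push_cast
  ring

/-- The factor `r - 2M` is why the radius `2M` is excluded: the coupling vanishes there. -/
lemma coupling_extremal (hs : s = 1 ∨ s = -1) (hφ : ∀ r, φ r = s * (√6 * M / (r - M)))
    (hr : r ≠ M) : coupling 2 (φ r) = r * (r - 2 * M) / (r - M) ^ 2 := by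
  have hr0 := sub_ne_zero.2 hr
  have hs2 : s ^ 2 = 1 := by rcases hs with rfl | rfl <;> norm_num
  have h6 : (√6 : ℝ) ^ 2 = 6 := Real.sq_sqrt (by norm_num)
  have hsq : φ r ^ 2 = 6 * M ^ 2 / (r - M) ^ 2 := by
    rw [hφ, mul_pow, hs2, div_pow, mul_pow, h6, one_mul]
  rw [coupling, hsq]
  field_simp
  push_cast
  ring

lemma isReciprocal_extremal (hχ : χ ≠ 0) (hf : ∀ r, f r = χ * (1 - M / r) ^ 2) :
    IsReciprocal {r : ℝ | 0 < r ∧ r ≠ M ∧ r ≠ 2 * M} 1 f f (fun r => (f r)⁻¹) where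
  isOpen := isOpen_extremal_radii M
  pos _ hr := hr.1
  smooth := by
    rw [funext hf]
    exact contDiffOn_const.mul ((contDiffOn_const.sub (contDiffOn_const.div contDiffOn_id
      fun _ hr => hr.1.ne')).pow 2)
  ne_zero r hr := by
    have h1 : 1 - M / r ≠ 0 := by
      rw [sub_ne_zero, ne_comm, Ne, div_eq_one_iff_eq hr.1.ne']
      exact hr.2.1.symm
    rw [hf]
    positivity
  c_pos := one_pos
  P_eq _ _ := (one_mul _).symm
  Q_eq _ _ := rfl

lemma contDiffOn_extremal_scalar (hφ : ∀ r, φ r = s * (√6 * M / (r - M))) :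
    ContDiffOn ℝ ∞ φ {r : ℝ | 0 < r ∧ r ≠ M ∧ r ≠ 2 * M} := by
  rw [funext hφ]
  exact contDiffOn_const.mul (contDiffOn_const.div (contDiffOn_id.sub contDiffOn_const)
    fun _ hr => sub_ne_zero.2 hr.2.1)

lemma stress_extremal (hχ : χ ≠ 0) (hs : s = 1 ∨ s = -1)
    (hf : ∀ r, f r = χ * (1 - M / r) ^ 2) (hφ : ∀ r, φ r = s * (√6 * M / (r - M)))
    (hr : r ∈ {r : ℝ | 0 < r ∧ r ≠ M ∧ r ≠ 2 * M}) :
    boxRadial 2 f (fun r => (f r)⁻¹) φ r = 0 ∧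
    stressTime 2 (coupling 2) f (fun r => (f r)⁻¹) φ r = -χ * M ^ 2 / r ^ 4 ∧
    stressRadius 2 (coupling 2) f (fun r => (f r)⁻¹) φ r = -χ * M ^ 2 / r ^ 4 ∧
    stressBase 2 (coupling 2) f (fun r => (f r)⁻¹) φ r = χ * M ^ 2 / r ^ 4 := by
  have h := isReciprocal_extremal hχ hf
  have hφs := contDiffOn_extremal_scalar hφ
  have hr0 := hr.1.ne'
  have hrM := sub_ne_zero.2 hr.2.1
  have hr2M := sub_ne_zero.2 hr.2.2
  have hs2 : s ^ 2 = 1 := by rcases hs with rfl | rfl <;> norm_num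
  have h6 : (√6 : ℝ) ^ 2 = 6 := Real.sq_sqrt (by norm_num)
  -- The stress tensor is even in `φ`, so the sign and `√6` enter it only through this square.
  have hw : (s * (√6 * M)) ^ 2 = 6 * M ^ 2 := by rw [mul_pow, hs2, mul_pow, h6, one_mul]
  have hf1 := (hasDerivAt_extremal hf hr0).deriv
  have hf2 := deriv_deriv_extremal hf hr0
  have hφ1 := (hasDerivAt_extremal_scalar hφ hr.2.1).deriv
  have hφ2 := deriv_deriv_extremal_scalar hφ hr.2.1
  have hbox : boxRadial 2 f (fun r => (f r)⁻¹) φ r = 0 := by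
    rw [h.boxRadial_eq hr, hf1, hf, hφ1, hφ2]
    push_cast
    field_simp
    ring
  have hφd : φ r * deriv φ r = -(6 * M ^ 2) / (r - M) ^ 3 := by
    rw [hφ1, hφ, ← hw]
    field_simp
  have hφq : deriv φ r ^ 2 = 6 * M ^ 2 / (r - M) ^ 4 := by
    rw [hφ1, ← hw]
    field_simp
  have hφdd : φ r * deriv (deriv φ) r = 12 * M ^ 2 / (r - M) ^ 4 := by
    have : 12 * M ^ 2 = 2 * (s * (√6 * M)) ^ 2 := by rw [hw]; ring
    rw [hφ2, hφ, this]
    field_simp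
  have hu1 := deriv_coupling_comp 2 h.isOpen hφs hr
  have hu2 := deriv_deriv_coupling_comp 2 h.isOpen hφs hr
  rw [mul_assoc, hφd] at hu1
  rw [hφq, hφdd] at hu2
  have hboxu := boxRadial_coupling 2 h hφs hr hbox
  refine ⟨hbox, ?_, ?_, ?_⟩
  · rw [stressTime, h.hessTime_eq hr, hboxu, h.gradSqRadial_eq hr, hu1, hφq,
      coupling_extremal hs hφ hr.2.1, hf1, hf]
    push_cast
    field_simp
    ring
  · rw [stressRadius, h.hessRadius_eq hr, hboxu, h.gradSqRadial_eq hr, hu1, hu2, hφq,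
      coupling_extremal hs hφ hr.2.1, hf1, hf]
    push_cast
    field_simp
    ring
  · rw [stressBase, h.hessBase_eq hr, hboxu, h.gradSqRadial_eq hr, hu1, hφq,
      coupling_extremal hs hφ hr.2.1, hf]
    push_cast
    field_simp
    ring

lemma ricci_extremal (hχ : χ ≠ 0) (hf : ∀ r, f r = χ * (1 - M / r) ^ 2)
    (hr : r ∈ {r : ℝ | 0 < r ∧ r ≠ M ∧ r ≠ 2 * M}) :
    ricciTime 2 f (fun r => (f r)⁻¹) r = -χ * M ^ 2 / r ^ 4 ∧
    ricciRadius 2 f (fun r => (f r)⁻¹) r = -χ * M ^ 2 / r ^ 4 ∧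
    ricciBase 2 χ f (fun r => (f r)⁻¹) r = χ * M ^ 2 / r ^ 4 := by
  have h := isReciprocal_extremal hχ hf
  have hr0 := hr.1.ne'
  have hf1 := (hasDerivAt_extremal hf hr0).deriv
  have hf2 := deriv_deriv_extremal hf hr0
  refine ⟨?_, ?_, ?_⟩
  · rw [h.ricciTime_eq hr, hf1, hf2]
    push_cast
    field_simp
    ring
  · rw [h.ricciRadius_eq hr, hf1, hf2]
    push_cast
    field_simp
    ring
  · rw [h.ricciBase_eq hr, hf1, hf]
    push_cast
    field_simp
    ring

lemma extremal_solution {U : Set (Fin 2 → ℝ)} {h : (Fin 2 → ℝ) → Matrix (Fin 2) (Fin 2) ℝ}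
    (hB : IsConstantCurvatureBase χ U h) (hχ : χ ≠ 0) (hs : s = 1 ∨ s = -1)
    {I : Set ℝ} (hI : I = {r | 0 < r ∧ r ≠ M ∧ r ≠ 2 * M})
    (hf : ∀ r, f r = χ * (1 - M / r) ^ 2) (hφ : ∀ r, φ r = s * (√6 * M / (r - M))) :
    (∀ r ∈ I, coupling 2 (φ r) ≠ 0) ∧
      FieldEquations (coupling 2) (staticMetric f (fun r => (f r)⁻¹) h) (radial 2 φ)
        (region I U) ∧
      RadialEqTime (coupling 2) (staticMetric f (fun r => (f r)⁻¹) h) (radial 2 φ)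
        (region I U) ∧
      AngularEqMul (coupling 2) (staticMetric f (fun r => (f r)⁻¹) h) (radial 2 φ)
        (region I U) (-1) ∧
      RadialEqPower (coupling 2) (staticMetric f (fun r => (f r)⁻¹) h) (radial 2 φ)
        (region I U) (-χ * M ^ 2) 4 := by
  subst hI
  have hb := (isReciprocal_extremal hχ hf).background
  rw [fieldEquations_iff one_le_two hb hB, radialEqTime_iff hb hB,
    angularEqMul_iff one_le_two hb hB, radialEqPower_iff hb hB]
  refine ⟨fun r hr => ?_, fun r hr => ?_, fun r hr => ?_, fun r hr => ?_, fun r hr => ?_⟩ <;>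
    obtain ⟨hbox, hst, hsr, hsb⟩ := stress_extremal hχ hs hf hφ hr
  · rw [coupling_extremal hs hφ hr.2.1]
    have := hr.1
    have hrM := sub_ne_zero.2 hr.2.1
    have hr2M := sub_ne_zero.2 hr.2.2
    positivity
  · obtain ⟨hrt, hrr, hrb⟩ := ricci_extremal hχ hf hr
    have hS : scalarRadial 2 χ f (fun r => (f r)⁻¹) r = 0 := by
      rw [scalarRadial, hrt, hrr, hrb]
      push_cast
      ring
    rw [RadialFieldEquations, hS, hrt, hrr, hrb, hst, hsr, hsb, hbox]
    simp
  · rw [hsr, hst]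
  · rw [hsb, hsr]
    ring
  · exact hsr
end

/-! ## Classification of the static solutions -/

section
variable {I : Set ℝ} {P Q φ : ℝ → ℝ} {χ : ℝ} {U : Set (Fin n → ℝ)}
    {h : (Fin n → ℝ) → Matrix (Fin n) (Fin n) ℝ}

lemma IsStaticConfiguration.background (hcfg : IsStaticConfiguration I P Q φ) :
    IsStaticBackground I P Q :=
  ⟨hcfg.isOpen, hcfg.pos, hcfg.smooth_P, hcfg.smooth_Q, hcfg.lorentzian⟩

lemma trace_equation (hn : 1 ≤ n) (hB : IsConstantCurvatureBase χ U h)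
    (hcfg : IsStaticConfiguration I P Q φ) {F : ℝ → ℝ}
    (hF : ∀ r ∈ I, ContDiffAt ℝ ∞ F (φ r)) (hF0 : ∀ r ∈ I, F (φ r) ≠ 0)
    (hfe : FieldEquations F (staticMetric P Q h) (radial n φ) (region I U)) :
    ∀ x ∈ region I U,
      ((n : ℝ) / 2 * F (radial n φ x) + ((n : ℝ) + 1) / 2 * deriv F (radial n φ x) ^ 2)
        * scalarCurvature (staticMetric P Q h) x =
      ((n : ℝ) / 2 + ((n : ℝ) + 1) * deriv (deriv F) (radial n φ x))
        * gradSq (staticMetric P Q h) (radial n φ) x := by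
  intro x hx
  have hb := hcfg.background
  rw [scalarCurvature_staticMetric hb hB hx, gradSq_radial hb hB hx]
  exact ((fieldEquations_iff hn hb hB F φ).1 hfe _ hx.1).trace hb hcfg.smooth_φ hF
    (hF0 _ hx.1) hx.1

lemma deriv_deriv_coupling_of_scalarCurvature_eq_zero (hn : 1 ≤ n)
    (hB : IsConstantCurvatureBase χ U h) (hcfg : IsStaticConfiguration I P Q φ) {F : ℝ → ℝ}
    (hF : ∀ r ∈ I, ContDiffAt ℝ ∞ F (φ r)) (hF0 : ∀ r ∈ I, F (φ r) ≠ 0)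
    (hfe : FieldEquations F (staticMetric P Q h) (radial n φ) (region I U))
    (hφ' : ∀ r ∈ I, deriv φ r ≠ 0)
    (hR : ∀ x ∈ region I U, scalarCurvature (staticMetric P Q h) x = 0) :
    ∀ r ∈ I, (n : ℝ) / 2 + ((n : ℝ) + 1) * deriv (deriv F) (φ r) = 0 := by
  intro r hr
  have hb := hcfg.background
  obtain ⟨x, hx, rfl⟩ := exists_mem_region hB hr
  have := trace_equation hn hB hcfg hF hF0 hfe x hx
  rw [hR x hx, mul_zero, gradSq_radial hb hB hx, eq_comm, mul_eq_zero] at this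
  exact this.resolve_right (div_ne_zero (pow_ne_zero 2 (hφ' _ hr)) (hb.Q_ne_zero hr))

lemma mul_eq_const_of_fieldEquations (hn : 1 ≤ n) (hB : IsConstantCurvatureBase χ U h)
    (hcfg : IsStaticConfiguration I P Q φ) {F : ℝ → ℝ}
    (hfe : FieldEquations F (staticMetric P Q h) (radial n φ) (region I U))
    (hrt : RadialEqTime F (staticMetric P Q h) (radial n φ) (region I U)) :
    ∃ c : ℝ, 0 < c ∧ ∀ r ∈ I, P r * Q r = c := by
  have hb := hcfg.background
  rw [fieldEquations_iff hn hb hB] at hfe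
  rw [radialEqTime_iff hb hB] at hrt
  refine mul_eq_const_of_ricci hn hb hcfg.ordConnected hcfg.nonempty fun r hr => ?_
  obtain ⟨h1, h2, -⟩ := hfe r hr
  linear_combination h2 - h1 + hrt r hr

lemma power_law_classification (hn : 1 ≤ n) (hB : IsConstantCurvatureBase χ U h)
    (hcfg : IsStaticConfiguration I P Q φ) (hF0 : ∀ r ∈ I, coupling n (φ r) ≠ 0)
    (hPQ : ∃ c : ℝ, 0 < c ∧ ∀ r ∈ I, P r * Q r = c)
    (hbox : ∀ x ∈ region I U, box (staticMetric P Q h) (radial n φ) x = 0)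
    (hrt : RadialEqTime (coupling n) (staticMetric P Q h) (radial n φ) (region I U))
    (hne : ¬ ∃ φ₀ : ℝ, ∀ r ∈ I, φ r = φ₀) :
    (∃ M K b ε : ℝ, ε * ε = 1 ∧ K ≠ 0 ∧ b ≠ 0 ∧ ∀ r ∈ I, |r - M| = ε * (r - M) ∧ r ≠ M ∧
      φ r = K * |r - M| ^ (-((n : ℝ) / 2)) ∧
      (Q r)⁻¹ = b * |r - M| ^ (1 + (n : ℝ) / 2) / r ^ n) ∧
    AngularEqMul (coupling n) (staticMetric P Q h) (radial n φ) (region I U) (-2 / (n : ℝ)) ∧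
    (∀ k : ℝ,
      AngularEqMul (coupling n) (staticMetric P Q h) (radial n φ) (region I U) k →
      k = -2 / (n : ℝ)) ∧
    (∀ C : ℝ,
      RadialEqPower (coupling n) (staticMetric P Q h) (radial n φ) (region I U) C (n + 2) →
      n = 2 ∧ ∃ M b s : ℝ, M ≠ 0 ∧ b ≠ 0 ∧ (s = 1 ∨ s = -1) ∧ C = -b * M ^ 2 ∧
        ∀ r ∈ I, r ≠ M ∧ φ r = s * (√6 * M / (r - M)) ∧
          (Q r)⁻¹ = b * (1 - M / r) ^ 2) := by
  have hn0 : (n : ℝ) ≠ 0 := by positivity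
  have hn1 : (n : ℝ) + 1 ≠ 0 := by positivity
  have hb := hcfg.background
  have hφ := hcfg.smooth_φ
  obtain ⟨c, hc0, hPQ⟩ := hPQ
  have hrec := hb.isReciprocal hc0 hPQ
  have hbox' : ∀ r ∈ I, boxRadial n P Q φ r = 0 := by
    rw [← forall_mem_region_iff hB]
    intro x hx
    rw [← box_radial hb hB hx, hbox x hx]
  rw [radialEqTime_iff hb hB] at hrt
  simp only [angularEqMul_iff hn hb hB, radialEqPower_iff hb hB]
  obtain ⟨M, κ, hκ, hfi⟩ :=
    exists_first_integrals hn hrec hcfg.ordConnected hφ hF0 hbox' hrt hne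
  obtain ⟨ε, K, hε, hK, hpl⟩ :=
    exists_power_law hn hrec hcfg.ordConnected hcfg.nonempty hφ hfi
  have hε0 : ε ≠ 0 := left_ne_zero_of_mul (hε ▸ one_ne_zero)
  have hsb := fun r hr => stressBase_of_first_integrals hn hrec hφ hr (hbox' r hr)
    (hfi r hr).2.2.2.2
  have hsr := fun r hr => stressRadius_of_first_integrals hn hrec hφ hr (hbox' r hr) (hrt r hr)
    (hfi r hr).2.2.2.2
  have hang : ∀ r ∈ I, stressBase n (coupling n) P Q φ r =
      -2 / (n : ℝ) * stressRadius n (coupling n) P Q φ r := by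
    intro r hr
    have hr0 := hb.ne_zero hr
    have hF := hF0 r hr
    rw [hsb r hr, hsr r hr]
    field_simp
    ring
  refine ⟨⟨M, K, -2 * ε * κ / (n * K), ε, hε, hK, by simp [hε0, hκ, hn0, hK], fun r hr =>
    ⟨(hpl r hr).1, (hfi r hr).1, (hpl r hr).2⟩⟩, hang, fun k hk => ?_, fun C hC => ?_⟩
  -- `Tʳᵣ` has the factor `2M - r`; at any other radius it is nonzero and determines `k`.
  · obtain ⟨r, hr, hr2⟩ :=
      ((infinite_of_isOpen_of_nonempty hcfg.isOpen hcfg.nonempty).sdiff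
        (Set.finite_singleton (2 * M))).nonempty
    have hr2 : 2 * M - r ≠ 0 := sub_ne_zero.2 fun h => hr2 h.symm
    have hne0 : stressRadius n (coupling n) P Q φ r ≠ 0 := by
      rw [hsr r hr]
      exact mul_ne_zero (inv_ne_zero (hF0 r hr)) (div_ne_zero (mul_ne_zero (mul_ne_zero hn0
        (mul_ne_zero (hrec.ne_zero r hr) (pow_ne_zero 2 (hfi r hr).2.2.1))) hr2)
        (mul_ne_zero (mul_ne_zero four_ne_zero hn1) (hb.ne_zero hr)))
    exact mul_right_cancel₀ hne0 ((hk r hr).symm.trans (hang r hr))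
  · obtain ⟨rfl, h1, h2⟩ := stressRadius_power_law hn hrec hcfg.nonempty hφ hF0 hbox' hrt hκ hfi
      hε hK (fun r hr => ⟨(hpl r hr).1, (hpl r hr).2.1⟩) hC
    obtain ⟨b, s, hM0, hb0, hs, hCb, hform⟩ :=
      exists_extremal_form hrec hκ hε hK (fun r hr => (hfi r hr).1) hpl h1 h2
    exact ⟨rfl, M, b, s, hM0, hb0, hs, hCb, hform⟩

lemma solution_classification (hn : 1 ≤ n) (hB : IsConstantCurvatureBase χ U h)
    (hcfg : IsStaticConfiguration I P Q φ) (hF0 : ∀ r ∈ I, coupling n (φ r) ≠ 0)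
    (hfe : FieldEquations (coupling n) (staticMetric P Q h) (radial n φ) (region I U))
    (hrt : RadialEqTime (coupling n) (staticMetric P Q h) (radial n φ) (region I U))
    (hne : ¬ ∃ φ₀ : ℝ, ∀ r ∈ I, φ r = φ₀) :
    n = 2 ∧ χ ≠ 0 ∧ ∃ M c s : ℝ, M ≠ 0 ∧ 0 < c ∧ (s = 1 ∨ s = -1) ∧
      (∀ r ∈ I, r ≠ M ∧ P r = c * (χ * (1 - M / r) ^ 2) ∧
        Q r = (χ * (1 - M / r) ^ 2)⁻¹ ∧ φ r = s * (√6 * M / (r - M))) ∧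
      RadialEqPower (coupling n) (staticMetric P Q h) (radial n φ) (region I U)
        (-χ * M ^ 2) 4 := by
  have hb := hcfg.background
  obtain ⟨c, hc0, hPQ⟩ := mul_eq_const_of_fieldEquations hn hB hcfg hfe hrt
  have hrec := hb.isReciprocal hc0 hPQ
  have hinf := infinite_of_isOpen_of_nonempty hcfg.isOpen hcfg.nonempty
  have hfe' := (fieldEquations_iff hn hb hB _ _).1 hfe
  have hR : ∀ r ∈ I, scalarRadial n χ P Q r = 0 := fun r hr =>
    ((hfe' r hr).scalar_and_box_eq_zero hn hb hcfg.smooth_φ (hF0 r hr) hr).1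
  have hbox : ∀ x ∈ region I U, box (staticMetric P Q h) (radial n φ) x = 0 := fun x hx => by
    rw [box_radial hb hB hx]
    exact ((hfe' _ hx.1).scalar_and_box_eq_zero hn hb hcfg.smooth_φ (hF0 _ hx.1) hx.1).2
  -- This power law serves only to find the dimension; the final `M` comes from `hpow`.
  obtain ⟨⟨M₀, K, b₀, ε, hε, -, hb₀, hpl⟩, -, -, hpow⟩ :=
    power_law_classification hn hB hcfg hF0 ⟨c, hc0, hPQ⟩ hbox hrt hne
  obtain ⟨A, D, hAD⟩ := exists_integrals_of_scalarRadial_eq_zero hn hrec hcfg.ordConnected hR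
  obtain ⟨rfl, hχ⟩ := dimension_eq_two (χ := χ) (A := A) (D := D) hn hinf hε hb₀
    fun r hr => by
      refine ⟨(hpl r hr).1, ?_⟩
      have hr0 := hb.ne_zero hr
      have h1 := (hpl r hr).2.2.2
      have h2 := (hAD r hr).2
      rw [eq_div_iff (pow_ne_zero n hr0)] at h1
      linear_combination h2 - h1
  -- Since `R = 0`, the radial equation is `Tʳᵣ = Rʳᵣ = -D/r⁴`, and `4 = n + 2` is the exponent that
  -- `hpow` needs.
  have hD : RadialEqPower (coupling 2) (staticMetric P Q h) (radial 2 φ) (region I U) (-D) 4 := by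
    rw [radialEqPower_iff hb hB]
    intro r hr
    rw [← ricciRadius_of_integrals hrec hr (hR r hr) (hAD r hr).1 (hAD r hr).2,
      ← (hfe' r hr).2.1, hR r hr, mul_zero, sub_zero]
  obtain ⟨-, M, b, s, hM, -, hs, hDb, hform⟩ := hpow (-D) hD
  -- The two forms of `r² (f - χ)` are equated; their constant terms agree because `D = b M²`, so a
  -- factor `r` cancels.
  have hlin : ∀ r ∈ I, (b - χ) * r = A + 2 * b * M := by
    intro r hr
    have hr0 := hb.ne_zero hr
    have h1 := (hform r hr).2.2
    have h2 := (hAD r hr).2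
    rw [h1] at h2
    have h3 : r ^ 2 * (b * (1 - M / r) ^ 2) = b * (r - M) ^ 2 := by field_simp
    refine mul_right_cancel₀ hr0 ?_
    linear_combination h2 - h3 - hDb
  -- A linear function of `r` that takes the same value at two radii has slope zero.
  have hbχ : b = χ := by
    obtain ⟨r, hr⟩ := hcfg.nonempty
    obtain ⟨t, ht, htr⟩ := (hinf.sdiff (Set.finite_singleton r)).nonempty
    have h0 : (b - χ) * (t - r) = 0 := by linear_combination hlin t ht - hlin r hr
    exact sub_eq_zero.1 ((mul_eq_zero.1 h0).resolve_right (sub_ne_zero.2 htr))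
  subst hbχ
  refine ⟨rfl, hχ, M, c, s, hM, hc0, hs, fun r hr => ?_, ?_⟩
  · obtain ⟨h1, h2, h3⟩ := hform r hr
    exact ⟨h1, by rw [hrec.P_eq r hr, h3], by rw [← h3, inv_inv], h2⟩
  · rwa [hDb] at hD
end

end ScalarTensor

end

theorem mainTheorem4 (n : ℕ) (hn : 1 ≤ n) (χ : ℝ) (hχ : χ = 1 ∨ χ = 0 ∨ χ = -1)
    (U : Set (Fin n → ℝ)) (h : (Fin n → ℝ) → Matrix (Fin n) (Fin n) ℝ)
    (hB : IsConstantCurvatureBase χ U h) :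
    (∀ (I : Set ℝ) (P Q φ : ℝ → ℝ), IsStaticConfiguration I P Q φ →
      -- a general coupling function: the trace equation, and what `R = 0` forces on `F`
      (∀ F : ℝ → ℝ, (∀ r ∈ I, ContDiffAt ℝ ∞ F (φ r)) → (∀ r ∈ I, F (φ r) ≠ 0) →
        FieldEquations F (staticMetric P Q h) (radial n φ) (region I U) →
        (∀ x ∈ region I U,
          ((n : ℝ) / 2 * F (radial n φ x)
              + ((n : ℝ) + 1) / 2 * deriv F (radial n φ x) ^ 2)
            * scalarCurvature (staticMetric P Q h) x =
          ((n : ℝ) / 2 + ((n : ℝ) + 1) * deriv (deriv F) (radial n φ x))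
            * gradSq (staticMetric P Q h) (radial n φ) x) ∧
        ((∀ r ∈ I, deriv φ r ≠ 0) →
          (∀ x ∈ region I U, scalarCurvature (staticMetric P Q h) x = 0) →
          (∀ r ∈ I, (n : ℝ) / 2 + ((n : ℝ) + 1) * deriv (deriv F) (φ r) = 0) ∧
          ∃ C₁ C₂ : ℝ, ∀ r ∈ I,
            F (φ r) = -((n : ℝ) / (4 * ((n : ℝ) + 1))) * φ r ^ 2 + C₁ * φ r + C₂)) ∧
      -- the coupling function `F = 1 - n φ² / (4 (n + 1))`
      ((∀ r ∈ I, coupling n (φ r) ≠ 0) →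
        (FieldEquations (coupling n) (staticMetric P Q h) (radial n φ) (region I U) →
          ∀ x ∈ region I U, scalarCurvature (staticMetric P Q h) x = 0 ∧
            box (staticMetric P Q h) (radial n φ) x = 0) ∧
        (FieldEquations (coupling n) (staticMetric P Q h) (radial n φ) (region I U) →
          RadialEqTime (coupling n) (staticMetric P Q h) (radial n φ) (region I U) →
          ∃ c : ℝ, 0 < c ∧ ∀ r ∈ I, P r * Q r = c) ∧
        -- consequences of `∇²φ = 0` and `Tʳᵣ = Tᵗₜ` once `g_tt g_rr` is constant
        ((∃ c : ℝ, 0 < c ∧ ∀ r ∈ I, P r * Q r = c) →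
          (∀ x ∈ region I U, box (staticMetric P Q h) (radial n φ) x = 0) →
          RadialEqTime (coupling n) (staticMetric P Q h) (radial n φ) (region I U) →
          (¬ ∃ φ₀ : ℝ, ∀ r ∈ I, φ r = φ₀) →
          (∃ M K b : ℝ, K ≠ 0 ∧ b ≠ 0 ∧ ∀ r ∈ I, r ≠ M ∧
            φ r = K * |r - M| ^ (-((n : ℝ) / 2)) ∧
            (Q r)⁻¹ = b * |r - M| ^ (1 + (n : ℝ) / 2) / r ^ n) ∧
          AngularEqMul (coupling n) (staticMetric P Q h) (radial n φ) (region I U)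
            (-2 / (n : ℝ)) ∧
          (∀ k : ℝ,
            AngularEqMul (coupling n) (staticMetric P Q h) (radial n φ) (region I U) k →
            k = -2 / (n : ℝ)) ∧
          (∀ C : ℝ,
            RadialEqPower (coupling n) (staticMetric P Q h) (radial n φ) (region I U) C (n + 2) →
            n = 2 ∧ ∃ M b s : ℝ, M ≠ 0 ∧ b ≠ 0 ∧ (s = 1 ∨ s = -1) ∧ C = -b * M ^ 2 ∧
              ∀ r ∈ I, r ≠ M ∧ φ r = s * (Real.sqrt 6 * M / (r - M)) ∧
                (Q r)⁻¹ = b * (1 - M / r) ^ 2)) ∧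
        -- all solutions of the field equations that satisfy the conditions of the theorem
        (∀ k : ℝ,
          FieldEquations (coupling n) (staticMetric P Q h) (radial n φ) (region I U) →
          RadialEqTime (coupling n) (staticMetric P Q h) (radial n φ) (region I U) →
          AngularEqMul (coupling n) (staticMetric P Q h) (radial n φ) (region I U) k →
          (¬ ∃ φ₀ : ℝ, ∀ r ∈ I, φ r = φ₀) →
          k = -2 / (n : ℝ) ∧ n = 2 ∧ χ ≠ 0 ∧
          ∃ M c s : ℝ, M ≠ 0 ∧ 0 < c ∧ (s = 1 ∨ s = -1) ∧
            (∀ r ∈ I, r ≠ M ∧ P r = c * (χ * (1 - M / r) ^ 2) ∧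
              Q r = (χ * (1 - M / r) ^ 2)⁻¹ ∧
              φ r = s * (Real.sqrt 6 * M / (r - M))) ∧
            RadialEqPower (coupling n) (staticMetric P Q h) (radial n φ) (region I U)
              (-χ * M ^ 2) 4))) ∧
    -- for `n = 2` and `χ = ±1` these are indeed solutions
    (n = 2 → χ ≠ 0 → ∀ M : ℝ, M ≠ 0 → ∀ s : ℝ, s = 1 ∨ s = -1 →
      ∀ (I : Set ℝ) (f φ : ℝ → ℝ), I = {r | 0 < r ∧ r ≠ M ∧ r ≠ 2 * M} →
        (∀ r, f r = χ * (1 - M / r) ^ 2) → (∀ r, φ r = s * (Real.sqrt 6 * M / (r - M))) →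
        (∀ r ∈ I, coupling n (φ r) ≠ 0) ∧
        FieldEquations (coupling n) (staticMetric f (fun r => (f r)⁻¹) h) (radial n φ)
          (region I U) ∧
        RadialEqTime (coupling n) (staticMetric f (fun r => (f r)⁻¹) h) (radial n φ)
          (region I U) ∧
        AngularEqMul (coupling n) (staticMetric f (fun r => (f r)⁻¹) h) (radial n φ)
          (region I U) (-1) ∧
        RadialEqPower (coupling n) (staticMetric f (fun r => (f r)⁻¹) h) (radial n φ)
          (region I U) (-χ * M ^ 2) 4) := by
  refine ⟨fun I P Q φ hcfg => ⟨fun F hF hF0 hfe => ⟨trace_equation hn hB hcfg hF hF0 hfe,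
    fun hφ' hR => ?_⟩, fun hF0 => ⟨fun hfe x hx => ?_,
    mul_eq_const_of_fieldEquations hn hB hcfg, fun hPQ hbox hrt hne => ?_,
    fun k hfe hrt hang hne => ?_⟩⟩, ?_⟩
  · have h2 := deriv_deriv_coupling_of_scalarCurvature_eq_zero hn hB hcfg hF hF0 hfe hφ' hR
    exact ⟨h2, coupling_form_of_deriv_deriv hcfg.isOpen hcfg.ordConnected hcfg.smooth_φ hF h2⟩
  · have hb := hcfg.background
    rw [scalarCurvature_staticMetric hb hB hx, box_radial hb hB hx]
    exact ((fieldEquations_iff hn hb hB _ _).1 hfe _ hx.1).scalar_and_box_eq_zero hn hb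
      hcfg.smooth_φ (hF0 _ hx.1) hx.1
  · obtain ⟨⟨M, K, b, _, _, hK, hb0, hpl⟩, h2, h3, h4⟩ :=
      power_law_classification hn hB hcfg hF0 hPQ hbox hrt hne
    exact ⟨⟨M, K, b, hK, hb0, fun r hr => (hpl r hr).2⟩, h2, h3, h4⟩
  · have hb := hcfg.background
    have hbox : ∀ x ∈ region I U, box (staticMetric P Q h) (radial n φ) x = 0 := fun x hx => by
      rw [box_radial hb hB hx]
      exact (((fieldEquations_iff hn hb hB _ _).1 hfe _ hx.1).scalar_and_box_eq_zero hn hb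
        hcfg.smooth_φ (hF0 _ hx.1) hx.1).2
    exact ⟨(power_law_classification hn hB hcfg hF0
      (mul_eq_const_of_fieldEquations hn hB hcfg hfe hrt) hbox hrt hne).2.2.1 k hang,
      solution_classification hn hB hcfg hF0 hfe hrt hne⟩
  · rintro rfl hχ0 M _ s hs I f φ hI hf hφ
    exact extremal_solution hB hχ0 hs hI hf hφ
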